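/- **Setting.** Let $Q_A,Q_B$ be disjoint finite sets and $\Sigma_A,\Sigma_B$ finite input alphabets. A process template $U\in\{A,B\}$ consists of the state set $Q_U$, an initial state ${\sf init}_U\in Q_U$ and a guarded transition relation $\delta_U\subseteq Q_U\times\Sigma_U\times\mathcal P(Q_A\cup Q_B)\times Q_U$; write $|B|=|Q_B|$. The disjunctive system $(A,B)^{(1,n)}$ has the processes $A,B_1,\dots,B_n$ (one copy of $A$, $n$ copies of $B$). A global state $s$ and a global input $e$ assign to every process $p$ a local state $s(p)$ and an input $e(p)$. A local transition $(q,\sigma,g,q')$ of process $p$ is enabled for $(s,e)$ if $s(p)=q$, $e(p)=\sigma$, and some process $p'\neq p$ has $s(p')\in g$; taking it replaces $s(p)$ by $q'$ and changes no other local state. A process is enabled for $(s,e)$ if one of its transitions is, and disabled otherwise. A run is a sequence of configurations $(s_1,e_1,p_1),(s_2,e_2,p_2),\dots$ such that all processes are in their initial states in $s_1$; for consecutive configurations, $s_{t+1}$ results from $s_t$ by an enabled transition (for $(s_t,e_t)$) of the process $p_t$, and $e_{t+1}(p)=e_t(p)$ for all $p\ne p_t$; and the run is either infinite, or ends in a configuration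 $(s,e,\bot)$ where all processes are disabled for $(s,e)$. An infinite run is strong-fair if every process that is enabled infinitely often moves infinitely often; it is locally deadlocked if some process is disabled from some moment on. A system has a *local deadlock* if it has an infinite strong-fair run that is locally deadlocked, a *global deadlock* if it has a finite run, and a *deadlock* if it has a local or a global deadlock. (So only strong-fair or finite runs are considered.) A number $c$ is a *cutoff* for (local, global) deadlock detection if for all $n\ge c$: $(A,B)^{(1,n)}$ has a (local, global) deadlock iff $(A,B)^{(1,c)}$ does. **Statement.** For all templates $A,B$: 1. (Bounding) Let $c=2|B|-1$ and $n>c$. - If $|B|\ge 2$ and $(A,B)^{(1,n)}$ has a local deadlock, then $(A,B)^{(1,c)}$ has a local deadlock. - If $(A,B)^{(1,n)}$ has a global deadlock, then $(A,B)^{(1,c)}$ has a global deadlock. - If $(A,B)^{(1,n)}$ has a deadlock, then $(A,B)^{(1,c)}$ has a deadlock. 2. (Monotonicity) For all $n\ge|B|+1$: if $(A,B)^{(1,n)}$ has a local deadlock (respectively a global deadlock, a deadlock), then so does $(A,B)^{(1,n+1)}$. 3. (Cutoff) If $|B|\ge2$, then $2|B|-1$ is a cutoff for deadlock detection, and likewise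 for local and for global deadlock detection. -/

import Mathlib

/-!
Guarded protocols with disjunctive guards: one copy of a template `A` in parallel with `n` copies
of a template `B`, interleaving semantics, and deadlocks on strong-fair or finite runs.
-/

namespace GuardedProtocol

/-- A process template with set of states `Q` and input alphabet `I`, in a system whose two
templates have the sets of states `QA` and `QB`. A local transition is a quadruple
`(q, σ, g, q')`, where the guard `g` is a subset of the disjoint union of `QA` and `QB`. -/
structure Template (QA QB Q I : Type*) where
  init : Q
  delta : Set (Q × I × Set (QA ⊕ QB) × Q)

/-- The processes `A, B₁, …, Bₙ` of the system with `n` copies of `B`. -/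
inductive Proc (n : ℕ) where
  | a : Proc n
  | b (i : Fin n) : Proc n

/-- Global states `(q_A, q_{B_1}, …, q_{B_n})`. -/
abbrev GState (QA QB : Type*) (n : ℕ) := QA × (Fin n → QB)

/-- Global inputs `(σ_A, σ_{B_1}, …, σ_{B_n})`. -/
abbrev GInput (IA IB : Type*) (n : ℕ) := IA × (Fin n → IB)

/-- The component of process `p` in a global state (or global input), as an element of the
disjoint union. -/
def component {X Y : Type*} {n : ℕ} (s : X × (Fin n → Y)) : Proc n → X ⊕ Y
  | .a => Sum.inl s.1
  | .b i => Sum.inr (s.2 i)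

/-- Disjunctive interpretation of guards: `(s, p) ⊨ g` iff some process other than `p` is in a
local state that belongs to `g`. -/
def Satisfies {QA QB : Type*} {n : ℕ} (s : GState QA QB n) (p : Proc n)
    (g : Set (QA ⊕ QB)) : Prop :=
  ∃ p', p' ≠ p ∧ component s p' ∈ g

section System

variable {QA QB IA IB : Type*} (A : Template QA QB QA IA) (B : Template QA QB QB IB) {n : ℕ}

/-- `Step A B s e p s'`: from the global state `s` under the global input `e`, process `p` can
take an enabled local transition that leads to the global state `s'`. -/
def Step (s : GState QA QB n) (e : GInput IA IB n) : Proc n → GState QA QB n → Prop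
  | .a, s' => ∃ g q', (s.1, e.1, g, q') ∈ A.delta ∧ Satisfies s .a g ∧ s' = (q', s.2)
  | .b i, s' => ∃ g q', (s.2 i, e.2 i, g, q') ∈ B.delta ∧ Satisfies s (.b i) g ∧
      s' = (s.1, Function.update s.2 i q')

/-- Process `p` is enabled for `s` and `e`: at least one of its local transitions is. -/
def Enabled (s : GState QA QB n) (e : GInput IA IB n) (p : Proc n) : Prop :=
  ∃ s', Step A B s e p s'

/-- The global initial state. -/
def initState (n : ℕ) : GState QA QB n := (A.init, fun _ => B.init)

/-- A configuration `(s, e, p)`, where `p` is the process that moves, or `none` for the special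
symbol `⊥`. -/
structure Config (QA QB IA IB : Type*) (n : ℕ) where
  state : GState QA QB n
  input : GInput IA IB n
  proc : Option (Proc n)

/-- Consecutive configurations of a path: the process named in the first one takes one of its
enabled local transitions, and every process that does not move keeps its input. -/
def Succ (k k' : Config QA QB IA IB n) : Prop :=
  (∃ p, k.proc = some p ∧ Step A B k.state k.input p k'.state) ∧
  ∀ p, k.proc ≠ some p → component k'.input p = component k.input p

/-- Infinite runs: infinite paths that start in the initial state. -/
def IsInfiniteRun (x : ℕ → Config QA QB IA IB n) : Prop :=
  (x 0).state = initState A B n ∧ ∀ t, Succ A B (x t) (x (t + 1))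

/-- Finite runs `x 0, …, x d`: finite paths that start in the initial state and end in a
configuration `(s, e, ⊥)`, where all processes are disabled for `s` and `e`. The values of `x`
after `d` play no role. -/
def IsFiniteRun (d : ℕ) (x : ℕ → Config QA QB IA IB n) : Prop :=
  (x 0).state = initState A B n ∧ (∀ t < d, Succ A B (x t) (x (t + 1))) ∧
  (x d).proc = none ∧ ∀ p, ¬ Enabled A B (x d).state (x d).input p

/-- Strong fairness of an infinite run: every process that is enabled infinitely often moves
infinitely often. -/
def StrongFair (x : ℕ → Config QA QB IA IB n) : Prop :=
  ∀ p, (∀ m, ∃ t ≥ m, Enabled A B (x t).state (x t).input p) →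
    ∀ m, ∃ t ≥ m, (x t).proc = some p

/-- An infinite run is locally deadlocked for `p` if `p` is disabled from some moment on. -/
def LocallyDeadlockedFor (x : ℕ → Config QA QB IA IB n) (p : Proc n) : Prop :=
  ∃ m, ∀ t ≥ m, ¬ Enabled A B (x t).state (x t).input p

/-- The disjunctive system with `n` copies of `B` has a local deadlock on strong-fair runs. -/
def HasLocalDeadlock (n : ℕ) : Prop :=
  ∃ x : ℕ → Config QA QB IA IB n,
    IsInfiniteRun A B x ∧ StrongFair A B x ∧ ∃ p, LocallyDeadlockedFor A B x p

/-- The disjunctive system with `n` copies of `B` has a global deadlock, that is, a finite run. -/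
def HasGlobalDeadlock (n : ℕ) : Prop :=
  ∃ (d : ℕ) (x : ℕ → Config QA QB IA IB n), IsFiniteRun A B d x

/-- The disjunctive system with `n` copies of `B` has a deadlock, local or global, on strong-fair
or finite runs. -/
def HasDeadlock (n : ℕ) : Prop :=
  HasLocalDeadlock A B n ∨ HasGlobalDeadlock A B n

end System

/-- `c` is a cutoff for the detection of `P`, where `P n` says that the system with `n` copies of
`B` has a deadlock (of some kind). -/
def IsCutoff (P : ℕ → Prop) (c : ℕ) : Prop :=
  ∀ n ≥ c, (P n ↔ P c)

end GuardedProtocol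

/-! A deadlocked run can be made into a lasso, ultimately periodic and such that from time `t₀` on
every process is either stuck or moves in each period: for infinite runs because there are finitely
many situations, for finite ones by idling at the end (the two `exists_lasso`). A system with
another number of copies then simulates the lasso. Each copy follows a trace, which at each time
idles or joins in the move that some `B_j` makes; one step of the lasso becomes a sequence of moves.
As guards are disjunctive, it suffices that the state of every `B_j` that does not move is also held
by an idle copy (`Lasso.exists_path_succ`). Conversely, a stuck process remains disabled as long as
it is shown only states that it already saw, without effect, after `t₀`
(`Lasso.not_enabled_of_deadCopy`).

The processes that must not be duplicated are the solo ones, which are stuck in a state that they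
never see, so that two copies would see each other. Solo processes sit in distinct states; hence for
`n > |B|` some process is not solo, and duplicating it gives monotonicity.

For bounding, the other processes are replaced by few copies. A visited state that is not recurrent
(not visited after `t₀`) needs one copy, which arrives with the first visitor and leaves with the
last one. A recurrent state where a process is stuck needs one copy that stays. Any other recurrent
state needs two: by fairness a copy may not wait there forever, so two copies take turns in
following a live process that passes through the state. With `E` the set of states that get a second
copy, this makes `#solo + |visited| + |E|` copies (`Lasso.deadlock_of_card`), at most `2|B|` because
`#solo + |recurrent| ≤ |B|`.

If the bound `2|B|` is attained, then `E` is the set of recurrent states, all states are visited,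
and one copy must be saved. If some state `q` is not recurrent, the second copy of a pair can serve
`q` before it is needed in its pair (`Lasso.hasLocalDeadlock_of_evac`). If all states are recurrent
and some process commutes between two of them, three copies in rotation hold both
(`Lasso.exists_core_three`). If no process ever changes its state, the copies run in self-loops and
a situation is built by hand (`Lasso.deadlock_of_static`); here `|B| = 1` may yield only a global
deadlock. -/

namespace GuardedProtocol

/-! ### Finite paths and loops as sources of global and local deadlocks -/

section Paths

variable {QA QB IA IB : Type*} {A : Template QA QB QA IA} {B : Template QA QB QB IB} {n : ℕ}

/-- A global state together with a global input. -/
abbrev Situation (QA QB IA IB : Type*) (n : ℕ) := GState QA QB n × GInput IA IB n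

variable (A B) in
/-- Process `p` moves, and all other processes keep their inputs. -/
def Move (p : Proc n) (c c' : Situation QA QB IA IB n) : Prop :=
  Step A B c.1 c.2 p c'.1 ∧ ∀ p', p' ≠ p → component c'.2 p' = component c.2 p'

variable (A B) in
/-- Finite paths, with the list of the situations left and of the processes that move there. -/
inductive Path : Situation QA QB IA IB n → List (Situation QA QB IA IB n × Proc n) →
    Situation QA QB IA IB n → Prop
  | nil (c : Situation QA QB IA IB n) : Path c [] c
  | cons {p : Proc n} {c c' c'' : Situation QA QB IA IB n}
      {l : List (Situation QA QB IA IB n × Proc n)} :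
      Move A B p c c' → Path c' l c'' → Path c ((c, p) :: l) c''

theorem Path.append {c c' c'' : Situation QA QB IA IB n}
    {l l' : List (Situation QA QB IA IB n × Proc n)} (h : Path A B c l c')
    (h' : Path A B c' l' c'') : Path A B c (l ++ l') c'' := by
  induction h with
  | nil => exact h'
  | cons hm _ ih => exact .cons hm (ih h')

theorem Path.single {p : Proc n} {c c' : Situation QA QB IA IB n} (h : Move A B p c c') :
    Path A B c [(c, p)] c' := .cons h (.nil _)

theorem Path.exists_fun {c c' : Situation QA QB IA IB n}
    {l : List (Situation QA QB IA IB n × Proc n)} (h : Path A B c l c') :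
    ∃ (f : ℕ → Situation QA QB IA IB n) (π : ℕ → Proc n), f 0 = c ∧ f l.length = c' ∧
      (∀ t < l.length, Move A B (π t) (f t) (f (t + 1)) ∧ (f t, π t) ∈ l) ∧
      ∀ k ∈ l, ∃ t < l.length, (f t, π t) = k := by
  induction h with
  | nil c => exact ⟨fun _ => c, fun _ => .a, rfl, rfl, by simp, by simp⟩
  | @cons p c c₁ c₂ l hm _ ih =>
    obtain ⟨f, π, h0, h1, h2, h3⟩ := ih
    refine ⟨fun t => Nat.casesOn t c f, fun t => Nat.casesOn t p π, rfl, h1, ?_, ?_⟩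
    · rintro (_ | t) ht
      · exact ⟨by simpa [h0] using hm, by simp⟩
      · have := h2 t (by simpa using ht)
        exact ⟨this.1, List.mem_cons_of_mem _ this.2⟩
    · intro k hk
      rcases List.mem_cons.1 hk with rfl | hk
      · exact ⟨0, by simp, rfl⟩
      · obtain ⟨t, ht, rfl⟩ := h3 k hk
        exact ⟨t + 1, by simpa using ht, rfl⟩

theorem Move.succ {p : Proc n} {c c' : Situation QA QB IA IB n} (h : Move A B p c c')
    {k k' : Config QA QB IA IB n} (h1 : k.state = c.1) (h2 : k.input = c.2)
    (h3 : k.proc = some p) (h4 : k'.state = c'.1) (h5 : k'.input = c'.2) : Succ A B k k' := by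
  refine ⟨⟨p, h3, by rw [h1, h2, h4]; exact h.1⟩, fun p' hp' => ?_⟩
  rw [h2, h5]
  exact h.2 p' fun e => hp' (by rw [h3, e])

theorem hasGlobalDeadlock_of_path {c₀ c : Situation QA QB IA IB n}
    {l : List (Situation QA QB IA IB n × Proc n)} (h₀ : c₀.1 = initState A B n)
    (h : Path A B c₀ l c) (hd : ∀ p, ¬ Enabled A B c.1 c.2 p) : HasGlobalDeadlock A B n := by
  obtain ⟨f, π, h0, h1, h2, -⟩ := h.exists_fun
  refine ⟨l.length, fun t => ⟨(f t).1, (f t).2, if t < l.length then some (π t) else none⟩,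
    by simp [h0, h₀], fun t ht => (h2 t ht).1.succ rfl rfl (by simp [ht]) rfl rfl, by simp, ?_⟩
  simpa [h1] using hd

/-- The loop is repeated forever. Strong fairness holds because each process moves in every round or
is disabled throughout it. -/
theorem hasLocalDeadlock_of_loop {c₀ c : Situation QA QB IA IB n}
    {l₀ l : List (Situation QA QB IA IB n × Proc n)} (h₀ : c₀.1 = initState A B n)
    (hp : Path A B c₀ l₀ c) (hl : Path A B c l c) (hne : l ≠ [])
    (hfair : ∀ p, (∃ c', (c', p) ∈ l) ∨ ∀ k ∈ l, ¬ Enabled A B k.1.1 k.1.2 p)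
    (hdead : ∃ p, ∀ k ∈ l, ¬ Enabled A B k.1.1 k.1.2 p) : HasLocalDeadlock A B n := by
  obtain ⟨f, π, f0, f1, f2, -⟩ := hp.exists_fun
  obtain ⟨g, ρ, g0, g1, g2, g3⟩ := hl.exists_fun
  have hpos : 0 < l.length := List.length_pos_iff.2 hne
  set d := l₀.length
  set e := l.length
  let F : ℕ → Situation QA QB IA IB n := fun t => if t < d then f t else g ((t - d) % e)
  let Q : ℕ → Proc n := fun t => if t < d then π t else ρ ((t - d) % e)
  have hF : ∀ t, t ≤ d → F t = f t := by
    intro t ht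
    rcases ht.lt_or_eq with ht | rfl
    · simp [F, ht]
    · simp [F, f1, g0]
  have hG : ∀ t, d ≤ t → F t = g ((t - d) % e) := fun t ht => by simp [F, ht.not_gt]
  have hρ : ∀ t, d ≤ t → Q t = ρ ((t - d) % e) := fun t ht => by simp [Q, ht.not_gt]
  have hmove : ∀ t, Move A B (Q t) (F t) (F (t + 1)) := by
    intro t
    rcases lt_or_ge t d with ht | ht
    · rw [hF t ht.le, hF (t + 1) ht]
      simpa [Q, ht] using (f2 t ht).1
    · rw [hG t ht, hG (t + 1) (by omega), hρ t ht]
      have hm := (g2 _ (Nat.mod_lt (t - d) hpos)).1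
      have h1 : t + 1 - d = t - d + 1 := by omega
      rw [h1, Nat.add_mod]
      by_cases he : e = 1
      · simp only [he, Nat.mod_one] at hm ⊢
        rw [he] at g1
        rwa [zero_add, g1, ← g0] at hm
      · rw [Nat.mod_eq_of_lt (show 1 < e by omega)]
        rcases lt_or_ge ((t - d) % e + 1) e with h2 | h2
        · rwa [Nat.mod_eq_of_lt h2]
        · have h3 : (t - d) % e + 1 = e := by have := Nat.mod_lt (t - d) hpos; omega
          rw [h3, g1, ← g0] at hm
          rwa [h3, Nat.mod_self]
  have hmem : ∀ t, d ≤ t → (F t, Q t) ∈ l := fun t ht => by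
    rw [hG t ht, hρ t ht]; exact (g2 _ (Nat.mod_lt (t - d) hpos)).2
  refine ⟨fun t => ⟨(F t).1, (F t).2, some (Q t)⟩, ⟨?_, fun t => (hmove t).succ rfl rfl rfl rfl rfl⟩,
    ?_, ?_⟩
  · simp [hF 0 (Nat.zero_le _), f0, h₀]
  · intro p hen k
    rcases hfair p with ⟨c', hc'⟩ | hdis
    · obtain ⟨t, ht, he⟩ := g3 _ hc'
      refine ⟨d + (t + e * k), by nlinarith, ?_⟩
      have : Q (d + (t + e * k)) = ρ t := by
        rw [hρ _ (by omega)]; simp [Nat.mod_eq_of_lt ht]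
      simp only [this]
      exact congrArg some (congrArg Prod.snd he)
    · obtain ⟨t, ht, h⟩ := hen d
      exact absurd h (hdis _ (hmem t ht))
  · obtain ⟨p, hp⟩ := hdead
    exact ⟨p, d, fun t ht => hp _ (hmem t ht)⟩

end Paths

/-! ### Reduction to ultimately periodic runs -/

section Lassos

variable {QA QB IA IB : Type*} {A : Template QA QB QA IA} {B : Template QA QB QB IB} {n : ℕ}

instance : Finite (Proc n) :=
  Finite.of_surjective (fun o : Option (Fin n) => o.elim Proc.a Proc.b) fun p => by
    cases p with
    | a => exact ⟨none, rfl⟩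
    | b i => exact ⟨some i, rfl⟩

variable (A B) in
/-- An ultimately periodic path, possibly with idle steps, where after `t₀` every process is
either disabled all the time or moves. -/
structure Lasso (x : ℕ → Config QA QB IA IB n) (t₀ P : ℕ) : Prop where
  init : (x 0).state = initState A B n
  step : ∀ t, Succ A B (x t) (x (t + 1)) ∨
    (x t).proc = none ∧ (x (t + 1)).state = (x t).state ∧ (x (t + 1)).input = (x t).input
  pos : 0 < P
  periodic : ∀ t ≥ t₀, x (t + P) = x t
  fair : ∀ p, (∀ t ≥ t₀, ¬ Enabled A B (x t).state (x t).input p) ∨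
    ∃ t ≥ t₀, (x t).proc = some p

theorem HasGlobalDeadlock.exists_lasso (h : HasGlobalDeadlock A B n) :
    ∃ (x : ℕ → Config QA QB IA IB n) (t₀ P : ℕ), Lasso A B x t₀ P ∧
      ∀ p, ∀ t ≥ t₀, ¬ Enabled A B (x t).state (x t).input p := by
  obtain ⟨d, x, h0, h1, h2, h3⟩ := h
  have hdead : ∀ p, ∀ t ≥ d, ¬ Enabled A B (x (min t d)).state (x (min t d)).input p := by
    intro p t ht
    rw [min_eq_right ht]
    exact h3 p
  refine ⟨fun t => x (min t d), d, 1, ⟨by simpa using h0, fun t => ?_, one_pos, fun t ht => ?_,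
    fun p => Or.inl (hdead p)⟩, hdead⟩
  · rcases lt_or_ge t d with ht | ht
    · left
      simpa [min_eq_left ht.le, min_eq_left (Nat.succ_le_of_lt ht)] using h1 t ht
    · right
      simp [min_eq_right ht, min_eq_right (ht.trans (Nat.le_succ t)), h2]
  · simp [min_eq_right ht, min_eq_right (show d ≤ t + 1 by omega)]

theorem Succ.congr_right {k k' k'' : Config QA QB IA IB n} (h : Succ A B k k')
    (h1 : k''.state = k'.state) (h2 : k''.input = k'.input) : Succ A B k k'' := by
  unfold Succ at *
  rwa [h1, h2]

/-- Some situation recurs infinitely often. The segment to be repeated begins at an occurrence `t₁`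
after all eventual deadlocks have set in, and ends at an occurrence `t₂` so late that all other
processes have moved in between. -/
theorem HasLocalDeadlock.exists_lasso [Finite QA] [Finite QB] [Finite IA] [Finite IB]
    (h : HasLocalDeadlock A B n) :
    ∃ (x : ℕ → Config QA QB IA IB n) (t₀ P : ℕ), Lasso A B x t₀ P ∧
      (∃ p, ∀ t ≥ t₀, ¬ Enabled A B (x t).state (x t).input p) ∧
      ∃ p, ∃ t ≥ t₀, (x t).proc = some p := by
  obtain ⟨x, ⟨h0, h1⟩, hf, p₀, hp₀⟩ := h
  have hT : ∃ T, ∀ p, LocallyDeadlockedFor A B x p →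
      ∀ t ≥ T, ¬ Enabled A B (x t).state (x t).input p := by
    have : ∀ p, ∃ m, LocallyDeadlockedFor A B x p →
        ∀ t ≥ m, ¬ Enabled A B (x t).state (x t).input p := by
      intro p
      by_cases hp : LocallyDeadlockedFor A B x p
      · obtain ⟨m, hm⟩ := hp
        exact ⟨m, fun _ => hm⟩
      · exact ⟨0, fun h => absurd h hp⟩
    choose f hf using this
    obtain ⟨M, hM⟩ := Finite.exists_le f
    exact ⟨M, fun p hp t ht => hf p hp t ((hM p).trans ht)⟩
  obtain ⟨T, hT⟩ := hT
  have hinf : ∀ p, ¬ LocallyDeadlockedFor A B x p → ∀ m, ∃ t ≥ m, (x t).proc = some p := by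
    intro p hp
    refine hf p fun m => ?_
    by_contra! hcon
    exact hp ⟨m, hcon⟩
  obtain ⟨c, hc⟩ := Finite.exists_infinite_fiber
    (fun t => ((x t).state, (x t).input) : ℕ → Situation QA QB IA IB n)
  have hrec : ∀ m, ∃ t > m, (x t).state = c.1 ∧ (x t).input = c.2 := by
    intro m
    obtain ⟨t, ht, hmt⟩ := (Set.infinite_coe_iff.1 hc).exists_gt m
    have : ((x t).state, (x t).input) = c := ht
    exact ⟨t, hmt, by rw [← this], by rw [← this]⟩
  obtain ⟨t₁, ht₁, hs₁, hi₁⟩ := hrec T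
  have hM : ∃ M, ∀ p, ¬ LocallyDeadlockedFor A B x p →
      ∃ t ≥ t₁, t ≤ M ∧ (x t).proc = some p := by
    have : ∀ p, ∃ t, ¬ LocallyDeadlockedFor A B x p → t ≥ t₁ ∧ (x t).proc = some p := by
      intro p
      by_cases hp : LocallyDeadlockedFor A B x p
      · exact ⟨0, fun h => absurd hp h⟩
      · obtain ⟨t, ht⟩ := hinf p hp t₁
        exact ⟨t, fun _ => ht⟩
    choose f hf using this
    obtain ⟨M, hM⟩ := Finite.exists_le f
    exact ⟨M, fun p hp => ⟨f p, (hf p hp).1, hM p, (hf p hp).2⟩⟩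
  obtain ⟨M, hM⟩ := hM
  obtain ⟨t₂, ht₂, hs₂, hi₂⟩ := hrec (max M t₁)
  have hlt : t₁ < t₂ := lt_of_le_of_lt (le_max_right _ _) ht₂
  have hMt : M < t₂ := lt_of_le_of_lt (le_max_left _ _) ht₂
  obtain ⟨P, rfl⟩ := Nat.exists_eq_add_of_lt hlt
  let X : ℕ → Config QA QB IA IB n := fun t =>
    if t < t₁ then x t else x (t₁ + (t - t₁) % (P + 1))
  have hX : ∀ t < t₁ + (P + 1), X t = x t := by
    intro t ht
    by_cases h : t < t₁
    · simp [X, h]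
    · simp only [X, h, if_false]
      rw [Nat.mod_eq_of_lt (by omega)]
      congr 1
      omega
  have hX' : ∀ t ≥ t₁, X t = x (t₁ + (t - t₁) % (P + 1)) := fun t ht => by simp [X, ht.not_gt]
  have hdis : ∀ p, LocallyDeadlockedFor A B x p →
      ∀ t ≥ t₁, ¬ Enabled A B (X t).state (X t).input p := by
    intro p hp t ht
    rw [hX' t ht]
    exact hT p hp _ (by omega)
  have hstep : ∀ t, Succ A B (X t) (X (t + 1)) := by
    intro t
    rcases lt_or_ge t t₁ with ht | ht
    · rw [hX t (by omega), hX (t + 1) (by omega)]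
      exact h1 t
    · rw [hX' t ht, hX' (t + 1) (by omega)]
      -- At the end of a round the next configuration is `x t₁` instead of `x t₂`. These share state
      -- and input but possibly not the scheduled process, which `Succ` does not inspect in its
      -- second argument.
      refine (h1 (t₁ + (t - t₁) % (P + 1))).congr_right ?_ ?_ <;>
      · rw [show t + 1 - t₁ = (t - t₁) + 1 by omega, Nat.add_mod (t - t₁) 1]
        have hlt := Nat.mod_lt (t - t₁) (Nat.succ_pos P)
        rcases Nat.eq_or_lt_of_le (Nat.succ_le_of_lt hlt) with h2 | h2
        · have h3 : ((t - t₁) % (P + 1) + 1 % (P + 1)) % (P + 1) = 0 := by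
            rw [← Nat.add_mod]
            exact Nat.mod_eq_zero_of_dvd (by
              rw [Nat.dvd_iff_mod_eq_zero, Nat.add_mod]
              rcases P with _ | P
              · simp [Nat.mod_one]
              · rw [Nat.mod_eq_of_lt (show 1 < P + 1 + 1 by omega), show
                  (t - t₁) % (P + 1 + 1) + 1 = P + 1 + 1 from h2, Nat.mod_self])
          rw [h3, add_zero, add_assoc, show (t - t₁) % (P + 1) + 1 = P + 1 from h2]
          simp only [hs₁, hi₁, ← add_assoc, hs₂, hi₂]
        · have h2' : (t - t₁) % (P + 1) + 1 < P + 1 := h2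
          rw [Nat.mod_eq_of_lt (show 1 < P + 1 by omega), Nat.mod_eq_of_lt h2', add_assoc]
  refine ⟨X, t₁, P + 1, ⟨?_, fun t => Or.inl (hstep t), Nat.succ_pos P, fun t ht => ?_,
    fun p => ?_⟩, ⟨p₀, hdis p₀ hp₀⟩, ?_⟩
  · rw [hX 0 (by omega)]
    exact h0
  · rw [hX' t ht, hX' (t + (P + 1)) (by omega), show t + (P + 1) - t₁ = t - t₁ + (P + 1) by omega,
      Nat.add_mod_right]
  · by_cases hp : LocallyDeadlockedFor A B x p
    · exact Or.inl (hdis p hp)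
    · obtain ⟨t, ht, htM, hproc⟩ := hM p hp
      exact Or.inr ⟨t, ht, by rw [hX t (by omega)]; exact hproc⟩
  · obtain ⟨⟨p, hp, -⟩, -⟩ := hstep t₁
    exact ⟨p, t₁, le_rfl, hp⟩

end Lassos

/-! ### Simulating a lasso by copies that follow traces -/

section Simulation

variable {QA QB IA IB : Type*} {A : Template QA QB QA IA} {B : Template QA QB QB IB} {n m : ℕ}
  {x : ℕ → Config QA QB IA IB n} {t₀ P : ℕ}

/-- The local state and the local input of the process `B_j` at time `t`. -/
def loc (x : ℕ → Config QA QB IA IB n) (j : Fin n) (t : ℕ) : QB × IB :=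
  ((x t).state.2 j, (x t).input.2 j)

/-- A process of the simulating system: at time `t` it idles, or it moves together with the process
`B_j` that moves in `x`. The input after a move is arbitrary. -/
structure Trace (x : ℕ → Config QA QB IA IB n) where
  z : ℕ → QB × IB
  mv : ℕ → Prop
  idle : ∀ t, ¬ mv t → z (t + 1) = z t
  move : ∀ t, mv t → ∃ j, (x t).proc = some (.b j) ∧ z t = loc x j t ∧
    (z (t + 1)).1 = (loc x j (t + 1)).1

/-- The situation where the copies of `B` follow the given traces. -/
def copies (x : ℕ → Config QA QB IA IB n) (ζ : Fin m → Trace x) (t : ℕ) :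
    Situation QA QB IA IB m :=
  (((x t).state.1, fun i => ((ζ i).z t).1), ((x t).input.1, fun i => ((ζ i).z t).2))

/-- Situations on the way from `copies x ζ t` to `copies x ζ (t + 1)`. -/
def Between (x : ℕ → Config QA QB IA IB n) (ζ : Fin m → Trace x) (t : ℕ)
    (c : Situation QA QB IA IB m) : Prop :=
  c.1.1 = (x t).state.1 ∧ c.2.1 = (x t).input.1 ∧
    ∀ i, (c.1.2 i, c.2.2 i) = (ζ i).z t ∨ (c.1.2 i, c.2.2 i) = (ζ i).z (t + 1)

theorem between_copies (ζ : Fin m → Trace x) (t : ℕ) : Between x ζ t (copies x ζ t) :=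
  ⟨rfl, rfl, fun _ => Or.inl rfl⟩

open scoped Classical in
/-- The copies in `I` have made their move at time `t`, and the others have not. -/
def partialCopies (x : ℕ → Config QA QB IA IB n) (ζ : Fin m → Trace x) (t : ℕ)
    (I : Finset (Fin m)) : Situation QA QB IA IB m :=
  (((x t).state.1, fun i => (if i ∈ I then (ζ i).z (t + 1) else (ζ i).z t).1),
    ((x t).input.1, fun i => (if i ∈ I then (ζ i).z (t + 1) else (ζ i).z t).2))

theorem between_partialCopies (ζ : Fin m → Trace x) (t : ℕ) (I : Finset (Fin m)) :
    Between x ζ t (partialCopies x ζ t I) := by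
  refine ⟨rfl, rfl, fun i => ?_⟩
  by_cases hi : i ∈ I
  · right; simp [partialCopies, hi]
  · left; simp [partialCopies, hi]

theorem Succ.a_eq {k k' : Config QA QB IA IB n} (h : Succ A B k k') (hp : k.proc ≠ some .a) :
    k'.state.1 = k.state.1 ∧ k'.input.1 = k.input.1 := by
  obtain ⟨⟨p, hp', hs⟩, hi⟩ := h
  refine ⟨?_, Sum.inl_injective (hi .a hp)⟩
  cases p with
  | a => exact absurd hp' hp
  | b i =>
    obtain ⟨g, q', -, -, h⟩ := hs
    rw [h]

theorem Succ.b_eq {k k' : Config QA QB IA IB n} (h : Succ A B k k') {j : Fin n}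
    (hp : k.proc ≠ some (.b j)) :
    k'.state.2 j = k.state.2 j ∧ k'.input.2 j = k.input.2 j := by
  obtain ⟨⟨p, hp', hs⟩, hi⟩ := h
  refine ⟨?_, Sum.inr_injective (hi (.b j) hp)⟩
  cases p with
  | a =>
    obtain ⟨g, q', -, -, h⟩ := hs
    rw [h]
  | b i =>
    obtain ⟨g, q', -, -, h⟩ := hs
    have hij : j ≠ i := fun e => hp (e ▸ hp')
    rw [h]
    exact Function.update_of_ne hij _ _

namespace Lasso

theorem loc_succ (h : Lasso A B x t₀ P) {t : ℕ} {j : Fin n} (hp : (x t).proc ≠ some (.b j)) :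
    loc x j (t + 1) = loc x j t := by
  rcases h.step t with hs | ⟨-, hs, hi⟩
  · exact Prod.ext (hs.b_eq hp).1 (hs.b_eq hp).2
  · simp [loc, hs, hi]

theorem a_succ (h : Lasso A B x t₀ P) {t : ℕ} (hp : (x t).proc ≠ some .a) :
    (x (t + 1)).state.1 = (x t).state.1 ∧ (x (t + 1)).input.1 = (x t).input.1 := by
  rcases h.step t with hs | ⟨-, hs, hi⟩
  · exact hs.a_eq hp
  · simp [hs, hi]

theorem step_of_proc (h : Lasso A B x t₀ P) {t : ℕ} {p : Proc n} (hp : (x t).proc = some p) :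
    Step A B (x t).state (x t).input p (x (t + 1)).state := by
  rcases h.step t with ⟨⟨p', hp', hs⟩, -⟩ | ⟨hn, -⟩
  · rw [hp] at hp'
    cases hp'
    exact hs
  · rw [hp] at hn
    cases hn

theorem periodic_mul (h : Lasso A B x t₀ P) {t : ℕ} (ht : t₀ ≤ t) (k : ℕ) :
    x (t + P * k) = x t := by
  induction k with
  | zero => rfl
  | succ k ih => rw [Nat.mul_succ, ← add_assoc, h.periodic _ (by omega), ih]

theorem exists_shift (h : Lasso A B x t₀ P) {t : ℕ} (ht : t₀ ≤ t) {s : ℕ} (hs : t₀ ≤ s) :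
    ∃ t', s ≤ t' ∧ t' < s + P ∧ x t' = x t := by
  have hP := h.pos
  refine ⟨s + (t + P * s - s) % P, Nat.le_add_right _ _, ?_, ?_⟩
  · have := Nat.mod_lt (t + P * s - s) hP; omega
  · have h1 := Nat.mod_add_div (t + P * s - s) P
    have h2 : s ≤ P * s := Nat.le_mul_of_pos_left _ hP
    rw [← h.periodic_mul (by omega) ((t + P * s - s) / P), ← h.periodic_mul ht s]
    congr 1
    omega

theorem proc_ne_of_disabled (h : Lasso A B x t₀ P) {p : Proc n}
    (hd : ∀ t ≥ t₀, ¬ Enabled A B (x t).state (x t).input p) {t : ℕ} (ht : t₀ ≤ t) :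
    (x t).proc ≠ some p :=
  fun hp => hd t ht ⟨_, h.step_of_proc hp⟩

theorem loc_eq_of_disabled (h : Lasso A B x t₀ P) {j : Fin n}
    (hd : ∀ t ≥ t₀, ¬ Enabled A B (x t).state (x t).input (.b j)) {t : ℕ} (ht : t₀ ≤ t) :
    loc x j t = loc x j t₀ := by
  induction t, ht using Nat.le_induction with
  | base => rfl
  | succ t ht ih => rw [h.loc_succ (h.proc_ne_of_disabled hd ht), ih]

end Lasso

/-- The copies that take part move one after another, all with the transition of the lasso. The
process that satisfied its guard is `A` or a `B_j` that does not move; in the latter case an idle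
copy stands in for it during the whole sequence. -/
theorem Lasso.exists_path_succ (h : Lasso A B x t₀ P) (ζ : Fin m → Trace x) (t : ℕ)
    (hs : ∀ j, (x t).proc ≠ some (.b j) →
      ∃ i, ¬ (ζ i).mv t ∧ ((ζ i).z t).1 = (loc x j t).1) :
    ∃ l, Path A B (copies x ζ t) l (copies x ζ (t + 1)) ∧
      (∀ k ∈ l, Between x ζ t k.1) ∧ ((x t).proc = some .a → ∃ c, (c, .a) ∈ l) ∧
      ∀ i, (ζ i).mv t → ∃ c, (c, .b i) ∈ l := by
  classical
  by_cases ha : (x t).proc = some .a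
  · have hmv : ∀ i, ¬ (ζ i).mv t := by
      intro i hi
      obtain ⟨j, hj, -⟩ := (ζ i).move t hi
      rw [ha] at hj
      cases hj
    refine ⟨[(copies x ζ t, .a)], Path.single ⟨?_, ?_⟩, by simpa using between_copies ζ t,
      fun _ => ⟨_, List.mem_singleton.2 rfl⟩, fun i hi => absurd hi (hmv i)⟩
    · obtain ⟨g, q', hδ, ⟨p', hp', hg⟩, he⟩ := h.step_of_proc ha
      refine ⟨g, q', hδ, ?_, ?_⟩
      · cases p' with
        | a => exact absurd rfl hp'
        | b j =>
          obtain ⟨i, -, hi⟩ := hs j (by rw [ha]; simp)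
          refine ⟨.b i, by simp, ?_⟩
          have : component (copies x ζ t).1 (.b i) = component (x t).state (.b j) :=
            congrArg Sum.inr hi
          rw [this]
          exact hg
      · refine Prod.ext (by rw [copies, he]) (funext fun i => ?_)
        simp [copies, (ζ i).idle t (hmv i)]
    · intro p' hp'
      cases p' with
      | a => exact absurd rfl hp'
      | b i => simp [component, copies, (ζ i).idle t (hmv i)]
  · have hlast : ∀ I : Finset (Fin m), (∀ i, i ∈ I ↔ (ζ i).mv t) →
        partialCopies x ζ t I = copies x ζ (t + 1) := by
      intro I hI
      have hz : ∀ i, (if i ∈ I then (ζ i).z (t + 1) else (ζ i).z t) = (ζ i).z (t + 1) := by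
        intro i
        by_cases hi : i ∈ I
        · simp [hi]
        · simp [hi, (ζ i).idle t fun h => hi ((hI i).2 h)]
      simp only [partialCopies, copies, hz, (h.a_succ ha).1, (h.a_succ ha).2]
    have hind : ∀ I : Finset (Fin m), (∀ i ∈ I, (ζ i).mv t) →
        ∃ l, Path A B (copies x ζ t) l (partialCopies x ζ t I) ∧ (∀ k ∈ l, Between x ζ t k.1) ∧
          ∀ i ∈ I, ∃ c, (c, .b i) ∈ l := by
      intro I
      induction I using Finset.induction_on with
      | empty =>
        intro _
        refine ⟨[], ?_, by simp, by simp⟩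
        simpa [partialCopies, copies] using
          Path.nil (A := A) (B := B) (copies x ζ t)
      | insert i I hi ih =>
        intro hI
        obtain ⟨l, hl, hb, hm⟩ := ih fun k hk => hI k (Finset.mem_insert_of_mem hk)
        obtain ⟨j, hj, hz, hz'⟩ := (ζ i).move t (hI i (Finset.mem_insert_self _ _))
        refine ⟨l ++ [(partialCopies x ζ t I, .b i)], hl.append (Path.single ⟨?_, ?_⟩), ?_, ?_⟩
        · obtain ⟨g, q', hδ, ⟨p', hp', hg⟩, he⟩ := h.step_of_proc hj
          have hzi : (if i ∈ I then (ζ i).z (t + 1) else (ζ i).z t) = loc x j t := by simp [hi, hz]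
          refine ⟨g, q', ?_, ?_, ?_⟩
          · simp only [partialCopies, hzi]
            exact hδ
          · cases p' with
            | a => exact ⟨.a, by simp, hg⟩
            | b j' =>
              -- The stand-in idles at time `t`, so it is neither the mover `i` nor a member of `I`,
              -- and it is still where it was.
              obtain ⟨i', hi', hzi'⟩ := hs j' (by rw [hj]; intro e; cases e; exact hp' rfl)
              have hne : i' ≠ i := fun e => hi' (e ▸ hI i (Finset.mem_insert_self _ _))
              have hnI : i' ∉ I := fun e => hi' (hI i' (Finset.mem_insert_of_mem e))
              refine ⟨.b i', fun e => hne (by cases e; rfl), ?_⟩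
              have : component (partialCopies x ζ t I).1 (.b i') = component (x t).state (.b j') :=
                congrArg Sum.inr (by simpa [partialCopies, hnI, loc] using hzi')
              rw [this]
              exact hg
          · refine Prod.ext rfl (funext fun k => ?_)
            have hq : ((ζ i).z (t + 1)).1 = q' := by
              rw [hz']
              simp [loc, he]
            by_cases hk : k = i
            · subst hk
              simp [partialCopies, hq]
            · simp [partialCopies, hk, Function.update_of_ne]
        · intro p' hp'
          cases p' with
          | a => rfl
          | b k =>
            have hk : k ≠ i := fun e => hp' (by rw [e])
            simp [component, partialCopies, hk]
        · intro k hk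
          rcases List.mem_append.1 hk with hk | hk
          · exact hb k hk
          · rw [List.mem_singleton.1 hk]
            exact between_partialCopies ζ t I
        · intro k hk
          rcases Finset.mem_insert.1 hk with rfl | hk
          · exact ⟨_, List.mem_append_right _ (List.mem_singleton.2 rfl)⟩
          · obtain ⟨c, hc⟩ := hm k hk
            exact ⟨c, List.mem_append_left _ hc⟩
    obtain ⟨l, hl, hb, hm⟩ := hind (Finset.univ.filter fun i => (ζ i).mv t) (by simp)
    rw [hlast _ (by simp)] at hl
    exact ⟨l, hl, hb, fun h => absurd h ha, fun i hi => hm i (by simpa using hi)⟩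

theorem Lasso.exists_path (h : Lasso A B x t₀ P) (ζ : Fin m → Trace x)
    (hs : ∀ t j, (x t).proc ≠ some (.b j) →
      ∃ i, ¬ (ζ i).mv t ∧ ((ζ i).z t).1 = (loc x j t).1) (t k : ℕ) :
    ∃ l, Path A B (copies x ζ t) l (copies x ζ (t + k)) ∧
      (∀ e ∈ l, ∃ t' ≥ t, Between x ζ t' e.1) ∧
      (∀ t', t ≤ t' → t' < t + k → (x t').proc = some .a → ∃ c, (c, .a) ∈ l) ∧
      ∀ i t', t ≤ t' → t' < t + k → (ζ i).mv t' → ∃ c, (c, .b i) ∈ l := by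
  induction k with
  | zero => exact ⟨[], .nil _, by simp, fun t' h1 h2 => by omega, fun i t' h1 h2 => by omega⟩
  | succ k ih =>
    obtain ⟨l, hl, hb, ha, hm⟩ := ih
    obtain ⟨l', hl', hb', ha', hm'⟩ := h.exists_path_succ ζ (t + k) (hs _)
    refine ⟨l ++ l', hl.append hl', ?_, ?_, ?_⟩
    · intro e he
      rcases List.mem_append.1 he with he | he
      · exact hb e he
      · exact ⟨t + k, by omega, hb' e he⟩
    · intro t' h1 h2 h3
      rcases lt_or_ge t' (t + k) with h4 | h4
      · obtain ⟨c, hc⟩ := ha t' h1 h4 h3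
        exact ⟨c, List.mem_append_left _ hc⟩
      · obtain rfl : t' = t + k := by omega
        obtain ⟨c, hc⟩ := ha' h3
        exact ⟨c, List.mem_append_right _ hc⟩
    · intro i t' h1 h2 h3
      rcases lt_or_ge t' (t + k) with h4 | h4
      · obtain ⟨c, hc⟩ := hm i t' h1 h4 h3
        exact ⟨c, List.mem_append_left _ hc⟩
      · obtain rfl : t' = t + k := by omega
        obtain ⟨c, hc⟩ := hm' i h3
        exact ⟨c, List.mem_append_right _ hc⟩

variable (A B) in
/-- From time `tw` on, the copy `i` is a disabled process `B_d` of `x`, and the other copies are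
in states that are seen by `B_d`. -/
def DeadCopy (x : ℕ → Config QA QB IA IB n) (t₀ tw : ℕ) (ζ : Fin m → Trace x) (i : Fin m) : Prop :=
  ∃ d, (∀ t ≥ t₀, ¬ Enabled A B (x t).state (x t).input (.b d)) ∧
    (∀ t ≥ tw, (ζ i).z t = loc x d t₀) ∧
    ∀ i' ≠ i, ∀ t ≥ tw, ∃ j ≠ d, ∃ t' ≥ t₀, ((ζ i').z t).1 = (loc x j t').1

/-- State and input of `B_d` are frozen from `t₀` on. A guard satisfied for its copy would therefore
have been satisfied for `B_d` itself at the time when it saw the same state. -/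
theorem Lasso.not_enabled_of_deadCopy (h : Lasso A B x t₀ P) {ζ : Fin m → Trace x} {tw : ℕ}
    (htw : t₀ ≤ tw) {i : Fin m} (hd : DeadCopy A B x t₀ tw ζ i) {t : ℕ} (ht : tw ≤ t)
    {c : Situation QA QB IA IB m} (hc : Between x ζ t c) : ¬ Enabled A B c.1 c.2 (.b i) := by
  obtain ⟨d, hdis, hz, hsee⟩ := hd
  rintro ⟨s', g, q', hδ, ⟨p', hp', hg⟩, -⟩
  have hloc : ∀ t' ≥ t₀, (c.1.2 i, c.2.2 i) = loc x d t' := by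
    intro t' ht'
    rw [h.loc_eq_of_disabled hdis ht']
    rcases hc.2.2 i with e | e
    · rw [e, hz t ht]
    · rw [e, hz (t + 1) (by omega)]
  have hδ' : ∀ t' ≥ t₀, ((x t').state.2 d, (x t').input.2 d, g, q') ∈ B.delta := by
    intro t' ht'
    have h1 := congrArg Prod.fst (hloc t' ht')
    have h2 := congrArg Prod.snd (hloc t' ht')
    simp only [loc] at h1 h2
    rw [← h1, ← h2]
    exact hδ
  cases p' with
  | a =>
    refine hdis t (htw.trans ht) ⟨_, g, q', hδ' t (htw.trans ht), ⟨.a, by simp, ?_⟩, rfl⟩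
    rw [component, hc.1] at hg
    exact hg
  | b i' =>
    have hi' : i' ≠ i := fun e => hp' (by rw [e])
    have : ∃ j ≠ d, ∃ t' ≥ t₀, c.1.2 i' = (loc x j t').1 := by
      rcases hc.2.2 i' with e | e
      · rw [show c.1.2 i' = ((ζ i').z t).1 from congrArg Prod.fst e]
        exact hsee i' hi' t ht
      · rw [show c.1.2 i' = ((ζ i').z (t + 1)).1 from congrArg Prod.fst e]
        exact hsee i' hi' (t + 1) (by omega)
    obtain ⟨j, hj, t', ht', he⟩ := this
    refine hdis t' ht' ⟨_, g, q', hδ' t' ht', ⟨.b j, fun e => hj (by cases e; rfl), ?_⟩, rfl⟩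
    rw [component, he] at hg
    exact hg

theorem Lasso.a_eq_of_disabled (h : Lasso A B x t₀ P)
    (hd : ∀ t ≥ t₀, ¬ Enabled A B (x t).state (x t).input .a) {t : ℕ} (ht : t₀ ≤ t) :
    (x t).state.1 = (x t₀).state.1 ∧ (x t).input.1 = (x t₀).input.1 := by
  induction t, ht using Nat.le_induction with
  | base => exact ⟨rfl, rfl⟩
  | succ t ht ih =>
    have := h.a_succ (h.proc_ne_of_disabled hd ht)
    exact ⟨this.1.trans ih.1, this.2.trans ih.2⟩

theorem Lasso.not_enabled_a (h : Lasso A B x t₀ P)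
    (hd : ∀ t ≥ t₀, ¬ Enabled A B (x t).state (x t).input .a)
    {c : Situation QA QB IA IB m} (h1 : c.1.1 = (x t₀).state.1) (h2 : c.2.1 = (x t₀).input.1)
    (h3 : ∀ i, ∃ j, ∃ t' ≥ t₀, c.1.2 i = (loc x j t').1) : ¬ Enabled A B c.1 c.2 .a := by
  rintro ⟨s', g, q', hδ, ⟨p', hp', hg⟩, -⟩
  cases p' with
  | a => exact absurd rfl hp'
  | b i =>
    obtain ⟨j, t', ht', he⟩ := h3 i
    obtain ⟨e1, e2⟩ := h.a_eq_of_disabled hd ht'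
    refine hd t' ht' ⟨_, g, q', ?_, ⟨.b j, by simp, ?_⟩, rfl⟩
    · rw [e1, e2, ← h1, ← h2]
      exact hδ
    · rw [component, he] at hg
      exact hg

theorem Lasso.copies_init (h : Lasso A B x t₀ P) {ζ : Fin m → Trace x}
    (hinit : ∀ i, ((ζ i).z 0).1 = B.init) : (copies x ζ 0).1 = initState A B m :=
  Prod.ext (show (x 0).state.1 = A.init by rw [h.init]; rfl) (funext hinit)

theorem Lasso.exists_path_zero (h : Lasso A B x t₀ P) (ζ : Fin m → Trace x)
    (hs : ∀ t j, (x t).proc ≠ some (.b j) →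
      ∃ i, ¬ (ζ i).mv t ∧ ((ζ i).z t).1 = (loc x j t).1) (t : ℕ) :
    ∃ l, Path A B (copies x ζ 0) l (copies x ζ t) := by
  obtain ⟨l, hl, -⟩ := h.exists_path ζ hs 0 t
  exact ⟨l, by rwa [zero_add] at hl⟩

/-- Copies that follow traces of a lasso, and loop from `tw` to `tw + Q`. -/
theorem Lasso.deadlock_of_traces (h : Lasso A B x t₀ P) (ζ : Fin m → Trace x)
    (hinit : ∀ i, ((ζ i).z 0).1 = B.init)
    (hs : ∀ t j, (x t).proc ≠ some (.b j) →
      ∃ i, ¬ (ζ i).mv t ∧ ((ζ i).z t).1 = (loc x j t).1)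
    {tw Q : ℕ} (htw : t₀ ≤ tw) (hQ : 0 < Q) (hPQ : P ∣ Q)
    (hper : ∀ i, (ζ i).z (tw + Q) = (ζ i).z tw)
    (htail : ∀ i, ∀ t ≥ tw, ∃ j, ∃ t' ≥ t₀, ((ζ i).z t).1 = (loc x j t').1)
    (hclass : ∀ i, (∃ t, tw ≤ t ∧ t < tw + Q ∧ (ζ i).mv t) ∨ DeadCopy A B x t₀ tw ζ i) :
    (((∃ t ≥ t₀, (x t).proc = some .a) ∨ ∃ i t, tw ≤ t ∧ t < tw + Q ∧ (ζ i).mv t) →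
      ((∀ t ≥ t₀, ¬ Enabled A B (x t).state (x t).input .a) ∨
        ∃ i, DeadCopy A B x t₀ tw ζ i) → HasLocalDeadlock A B m) ∧
    ((∀ t ≥ t₀, ¬ Enabled A B (x t).state (x t).input .a) →
      (∀ i, DeadCopy A B x t₀ tw ζ i) → HasGlobalDeadlock A B m) := by
  obtain ⟨l₀, hl₀⟩ := h.exists_path_zero ζ hs tw
  have hdeadA : (∀ t ≥ t₀, ¬ Enabled A B (x t).state (x t).input .a) →
      ∀ t ≥ tw, ∀ c, Between x ζ t c → ¬ Enabled A B c.1 c.2 .a := by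
    intro hA t ht c hc
    obtain ⟨e1, e2⟩ := h.a_eq_of_disabled hA (htw.trans ht)
    refine h.not_enabled_a hA (hc.1.trans e1) (hc.2.1.trans e2) fun i => ?_
    rcases hc.2.2 i with e | e
    · rw [show c.1.2 i = ((ζ i).z t).1 from congrArg Prod.fst e]
      exact htail i t ht
    · rw [show c.1.2 i = ((ζ i).z (t + 1)).1 from congrArg Prod.fst e]
      exact htail i (t + 1) (by omega)
  have hmoveA : (∃ t ≥ t₀, (x t).proc = some .a) →
      ∃ t, tw ≤ t ∧ t < tw + Q ∧ (x t).proc = some .a := by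
    rintro ⟨t, ht, hp⟩
    obtain ⟨t', h1, h2, h3⟩ := h.exists_shift ht htw
    exact ⟨t', h1, by have := Nat.le_of_dvd hQ hPQ; omega, by rw [h3, hp]⟩
  refine ⟨fun hmove hdead => ?_, fun hA hB => ?_⟩
  · obtain ⟨l, hl, hb, ha, hm⟩ := h.exists_path ζ hs tw Q
    have hcopies : copies x ζ (tw + Q) = copies x ζ tw := by
      obtain ⟨k, rfl⟩ := hPQ
      simp only [copies, hper, h.periodic_mul htw]
    rw [hcopies] at hl
    refine hasLocalDeadlock_of_loop (h.copies_init hinit) hl₀ hl ?_ ?_ ?_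
    · rintro rfl
      rcases hmove with hmove | ⟨i, t, h1, h2, h3⟩
      · obtain ⟨t, h1, h2, h3⟩ := hmoveA hmove
        obtain ⟨c, hc⟩ := ha t h1 h2 h3
        simp at hc
      · obtain ⟨c, hc⟩ := hm i t h1 h2 h3
        simp at hc
    · intro p
      cases p with
      | a =>
        rcases h.fair .a with hA | hA
        · right
          intro k hk
          obtain ⟨t, ht, hbt⟩ := hb k hk
          exact hdeadA hA t ht _ hbt
        · obtain ⟨t, h1, h2, h3⟩ := hmoveA hA
          exact Or.inl (ha t h1 h2 h3)
      | b i =>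
        rcases hclass i with ⟨t, h1, h2, h3⟩ | hd
        · exact Or.inl (hm i t h1 h2 h3)
        · right
          intro k hk
          obtain ⟨t, ht, hbt⟩ := hb k hk
          exact h.not_enabled_of_deadCopy htw hd ht hbt
    · rcases hdead with hA | ⟨i, hd⟩
      · refine ⟨.a, fun k hk => ?_⟩
        obtain ⟨t, ht, hbt⟩ := hb k hk
        exact hdeadA hA t ht _ hbt
      · refine ⟨.b i, fun k hk => ?_⟩
        obtain ⟨t, ht, hbt⟩ := hb k hk
        exact h.not_enabled_of_deadCopy htw hd ht hbt
  · refine hasGlobalDeadlock_of_path (h.copies_init hinit) hl₀ fun p => ?_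
    cases p with
    | a => exact hdeadA hA tw le_rfl _ (between_copies ζ tw)
    | b i => exact h.not_enabled_of_deadCopy htw (hB i) le_rfl (between_copies ζ tw)

end Simulation

/-! ### Solo processes, covers, and monotonicity -/

section Assembly

variable {QA QB IA IB : Type*} {A : Template QA QB QA IA} {B : Template QA QB QB IB} {n m : ℕ}
  {x : ℕ → Config QA QB IA IB n} {t₀ P : ℕ}

variable (A B) in
/-- The process `p` is disabled from time `t₀` on. -/
abbrev Stuck (x : ℕ → Config QA QB IA IB n) (t₀ : ℕ) (p : Proc n) : Prop :=
  ∀ t ≥ t₀, ¬ Enabled A B (x t).state (x t).input p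

variable (A B) in
/-- The process `B_d` is disabled from time `t₀` on, in a state that no other `B_j` visits then. -/
def Solo (x : ℕ → Config QA QB IA IB n) (t₀ : ℕ) (d : Fin n) : Prop :=
  Stuck A B x t₀ (.b d) ∧ ∀ j ≠ d, ∀ t ≥ t₀, (loc x j t).1 ≠ (loc x d t₀).1

/-- The trace of the process `B_j` itself. -/
def Lasso.exact (h : Lasso A B x t₀ P) (j : Fin n) : Trace x where
  z := loc x j
  mv t := (x t).proc = some (.b j)
  idle _ ht := h.loc_succ ht
  move _ ht := ⟨j, ht, rfl, rfl⟩

variable (A B) in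
/-- From time `tw` on, the trace is that of a disabled process that is not solo. -/
def DeadTrace (x : ℕ → Config QA QB IA IB n) (t₀ tw : ℕ) (ζ : Trace x) : Prop :=
  ∃ d, Stuck A B x t₀ (.b d) ∧ ¬ Solo A B x t₀ d ∧ ∀ t ≥ tw, ζ.z t = loc x d t₀

variable (A B) in
/-- A family of traces that can replace the processes that are not solo. -/
structure Cover {κ : Type*} (x : ℕ → Config QA QB IA IB n) (t₀ P : ℕ) (ζ : κ → Trace x)
    (tw Q : ℕ) : Prop where
  le : t₀ ≤ tw
  pos : 0 < Q
  dvd : P ∣ Q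
  init : ∀ k, ((ζ k).z 0).1 = B.init
  support : ∀ t j, ¬ Solo A B x t₀ j → (x t).proc ≠ some (.b j) →
    ∃ k, ¬ (ζ k).mv t ∧ ((ζ k).z t).1 = (loc x j t).1
  periodic : ∀ k, (ζ k).z (tw + Q) = (ζ k).z tw
  tail : ∀ k, ∀ t ≥ tw, ∃ j, ¬ Solo A B x t₀ j ∧ ∃ t' ≥ t₀, ((ζ k).z t).1 = (loc x j t').1
  live_or_dead : ∀ k, (∃ t, tw ≤ t ∧ t < tw + Q ∧ (ζ k).mv t) ∨ DeadTrace A B x t₀ tw (ζ k)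

theorem Lasso.loc_init (h : Lasso A B x t₀ P) (j : Fin n) : (loc x j 0).1 = B.init := by
  simp [loc, h.init, initState]

theorem Lasso.exact_live (h : Lasso A B x t₀ P) {j : Fin n} {tw Q : ℕ} (htw : t₀ ≤ tw)
    (hQ : 0 < Q) (hPQ : P ∣ Q) (hj : ¬ Stuck A B x t₀ (.b j)) :
    ∃ t, tw ≤ t ∧ t < tw + Q ∧ (h.exact j).mv t := by
  obtain ⟨t, ht, hp⟩ := (h.fair (.b j)).resolve_left hj
  obtain ⟨t', h1, h2, h3⟩ := h.exists_shift ht htw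
  refine ⟨t', h1, by have := Nat.le_of_dvd hQ hPQ; omega, ?_⟩
  rw [← h3] at hp
  exact hp

theorem Lasso.loc_periodic (h : Lasso A B x t₀ P) {Q : ℕ} (hPQ : P ∣ Q) (j : Fin n) {t : ℕ}
    (ht : t₀ ≤ t) : loc x j (t + Q) = loc x j t := by
  obtain ⟨k, rfl⟩ := hPQ
  simp only [loc, h.periodic_mul ht]

/-- Each solo process is copied exactly once, and all surplus copies repeat one trace `k₀` of the
cover. By `C.tail` the traces of the cover never show a solo process its own state, so that any
number of them does no harm. -/
theorem Cover.deadlock {κ : Type*} [Finite κ] [Nonempty κ] {ζ : κ → Trace x} {tw Q : ℕ}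
    (C : Cover A B x t₀ P ζ tw Q) (h : Lasso A B x t₀ P)
    (hm : Nat.card {d // Solo A B x t₀ d} + Nat.card κ ≤ m) :
    (((∃ t ≥ t₀, (x t).proc = some .a) ∨ ∃ k t, tw ≤ t ∧ t < tw + Q ∧ (ζ k).mv t) →
      (Stuck A B x t₀ .a ∨ (∃ d, Solo A B x t₀ d) ∨ ∃ k, DeadTrace A B x t₀ tw (ζ k)) →
        HasLocalDeadlock A B m) ∧
    (Stuck A B x t₀ .a → (∀ k, DeadTrace A B x t₀ tw (ζ k)) → HasGlobalDeadlock A B m) := by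
  obtain ⟨k₀⟩ := ‹Nonempty κ›
  obtain ⟨r, rfl⟩ := Nat.exists_eq_add_of_le hm
  let e : ({d // Solo A B x t₀ d} ⊕ κ) ⊕ Fin r ≃
      Fin (Nat.card {d // Solo A B x t₀ d} + Nat.card κ + r) :=
    Finite.equivFinOfCardEq (by simp [Nat.card_sum])
  let f : ({d // Solo A B x t₀ d} ⊕ κ) ⊕ Fin r → {d // Solo A B x t₀ d} ⊕ κ :=
    Sum.elim id fun _ => Sum.inr k₀
  let g : {d // Solo A B x t₀ d} ⊕ κ → Trace x := Sum.elim (fun d => h.exact d) ζ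
  let ξ := fun i => g (f (e.symm i))
  have hcases : ∀ i, (∃ d, e.symm i = .inl (.inl d) ∧ ξ i = h.exact d) ∨ ∃ k, ξ i = ζ k := by
    intro i
    rcases hi : e.symm i with (d | k) | s
    · exact Or.inl ⟨d, rfl, by simp [ξ, hi, f, g]⟩
    · exact Or.inr ⟨k, by simp [ξ, hi, f, g]⟩
    · exact Or.inr ⟨k₀, by simp [ξ, hi, f, g]⟩
  have hS : ∀ d : {d // Solo A B x t₀ d}, ∃ i, e.symm i = .inl (.inl d) ∧ ξ i = h.exact d :=
    fun d => ⟨e (.inl (.inl d)), by simp, by simp [ξ, f, g]⟩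
  have hκ : ∀ k, ∃ i, ξ i = ζ k := fun k => ⟨e (.inl (.inr k)), by simp [ξ, f, g]⟩
  have hdeadS : ∀ (d : {d // Solo A B x t₀ d}) i, e.symm i = .inl (.inl d) → ξ i = h.exact d →
      DeadCopy A B x t₀ tw ξ i := by
    intro d i hi hξ
    refine ⟨d, d.2.1, fun t ht => ?_, fun i' hi' t ht => ?_⟩
    · rw [hξ]
      exact h.loc_eq_of_disabled d.2.1 (C.le.trans ht)
    · rcases hcases i' with ⟨d', hd', hξ'⟩ | ⟨k, hk⟩
      · refine ⟨d', fun he => hi' ?_, t, C.le.trans ht, by rw [hξ']; rfl⟩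
        rw [← e.symm.injective.eq_iff, hd', hi, Subtype.ext he]
      · obtain ⟨j, hj, t', ht', he⟩ := C.tail k t ht
        exact ⟨j, fun e => hj (e ▸ d.2), t', ht', by rw [hk, he]⟩
  have htail : ∀ i, ∀ t ≥ tw, ∃ j, ∃ t' ≥ t₀, ((ξ i).z t).1 = (loc x j t').1 := by
    intro i t ht
    rcases hcases i with ⟨d, -, hξ⟩ | ⟨k, hξ⟩
    · exact ⟨d, t, C.le.trans ht, by rw [hξ]; rfl⟩
    · obtain ⟨j, -, t', ht', he⟩ := C.tail k t ht
      exact ⟨j, t', ht', by rw [hξ, he]⟩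
  have hdeadκ : ∀ k i, ξ i = ζ k → DeadTrace A B x t₀ tw (ζ k) → DeadCopy A B x t₀ tw ξ i := by
    rintro k i hi ⟨d, hd, hns, hz⟩
    refine ⟨d, hd, by rwa [hi], fun i' _ t ht => ?_⟩
    obtain ⟨j, t', ht', he⟩ := htail i' t ht
    -- The only state that `B_d` might fail to see is its own; as it is not solo, another process
    -- visits that state.
    by_cases hj : j = d
    · subst hj
      have : ∃ j' ≠ j, ∃ t ≥ t₀, (loc x j' t).1 = (loc x j t₀).1 := by
        by_contra! hcon
        exact hns ⟨hd, hcon⟩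
      obtain ⟨j', hj', s, hs, he'⟩ := this
      exact ⟨j', hj', s, hs, by rw [he, he', h.loc_eq_of_disabled hd ht']⟩
    · exact ⟨j, hj, t', ht', he⟩
  obtain ⟨h1, h2⟩ := h.deadlock_of_traces ξ
    (by
      intro i
      rcases hcases i with ⟨d, -, hξ⟩ | ⟨k, hξ⟩
      · rw [hξ]; exact h.loc_init d
      · rw [hξ]; exact C.init k)
    (by
      intro t j hp
      by_cases hj : Solo A B x t₀ j
      · obtain ⟨i, -, hi⟩ := hS ⟨j, hj⟩
        exact ⟨i, by rw [hi]; exact hp, by rw [hi]; rfl⟩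
      · obtain ⟨k, hk, hk'⟩ := C.support t j hj hp
        obtain ⟨i, hi⟩ := hκ k
        exact ⟨i, by rwa [hi], by rwa [hi]⟩)
    C.le C.pos C.dvd
    (by
      intro i
      rcases hcases i with ⟨d, -, hξ⟩ | ⟨k, hξ⟩
      · rw [hξ]; exact h.loc_periodic C.dvd d C.le
      · rw [hξ]; exact C.periodic k)
    htail
    (by
      intro i
      rcases hcases i with ⟨d, hi, hξ⟩ | ⟨k, hξ⟩
      · exact Or.inr (hdeadS d i hi hξ)
      · rw [hξ]
        exact (C.live_or_dead k).imp_right (hdeadκ k i hξ))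
  refine ⟨fun hmove hdead => h1 (hmove.imp_right ?_) (hdead.imp_right ?_), fun ha hk => ?_⟩
  · rintro ⟨k, t, ht⟩
    obtain ⟨i, hi⟩ := hκ k
    exact ⟨i, t, by rwa [hi]⟩
  · rintro (⟨d, hd⟩ | ⟨k, hk⟩)
    · obtain ⟨i, hi, hξ⟩ := hS ⟨d, hd⟩
      exact ⟨i, hdeadS _ i hi hξ⟩
    · obtain ⟨i, hi⟩ := hκ k
      exact ⟨i, hdeadκ k i hi hk⟩
  · refine h2 ha fun i => ?_
    rcases hcases i with ⟨d, hi, hξ⟩ | ⟨k, hξ⟩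
    · exact hdeadS d i hi hξ
    · exact hdeadκ k i hξ (hk k)

theorem solo_injective :
    Function.Injective fun d : {d // Solo A B x t₀ d} => (loc x d t₀).1 := by
  intro d d' he
  by_contra hne
  exact d.2.2 d' (fun e => hne (Subtype.ext e.symm)) t₀ le_rfl he.symm

theorem exists_not_solo (A : Template QA QB QA IA) (B : Template QA QB QB IB) [Fintype QB]
    (x : ℕ → Config QA QB IA IB n) (t₀ : ℕ) (hn : Fintype.card QB < n) :
    ∃ j, ¬ Solo A B x t₀ j := by
  by_contra! hall
  have := Fintype.card_le_of_injective (fun d : Fin n => (loc x d t₀).1) fun d d' he =>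
    congrArg Subtype.val (@solo_injective _ _ _ _ _ _ _ _ _ ⟨d, hall d⟩ ⟨d', hall d'⟩ he)
  rw [Fintype.card_fin] at this
  omega

theorem Lasso.cover_exact (h : Lasso A B x t₀ P) :
    Cover A B x t₀ P (fun j : {j // ¬ Solo A B x t₀ j} => h.exact j) t₀ P where
  le := le_rfl
  pos := h.pos
  dvd := dvd_rfl
  init k := h.loc_init k
  support t j hj hp := ⟨⟨j, hj⟩, hp, rfl⟩
  periodic k := h.loc_periodic dvd_rfl k le_rfl
  tail k t ht := ⟨k, k.2, t, ht, rfl⟩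
  live_or_dead k := by
    by_cases hk : Stuck A B x t₀ (.b k)
    · exact Or.inr ⟨k, hk, k.2, fun t ht => h.loc_eq_of_disabled hk ht⟩
    · exact Or.inl (h.exact_live le_rfl h.pos dvd_rfl hk)

theorem card_solo_add (A : Template QA QB QA IA) (B : Template QA QB QB IB)
    (x : ℕ → Config QA QB IA IB n) (t₀ : ℕ) :
    Nat.card {d // Solo A B x t₀ d} + Nat.card {j // ¬ Solo A B x t₀ j} = n := by
  classical
  rw [← Nat.card_sum, Nat.card_congr (Equiv.sumCompl _), Nat.card_fin]

/-- All processes are copied exactly, and the surplus copy duplicates one that is not solo. -/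
theorem HasGlobalDeadlock.succ [Fintype QB] (h : HasGlobalDeadlock A B n)
    (hn : Fintype.card QB < n) : HasGlobalDeadlock A B (n + 1) := by
  obtain ⟨x, t₀, P, hx, hd⟩ := h.exists_lasso
  obtain ⟨j, hj⟩ := exists_not_solo A B x t₀ hn
  have : Nonempty {j // ¬ Solo A B x t₀ j} := ⟨⟨j, hj⟩⟩
  refine (hx.cover_exact.deadlock hx (m := n + 1) ?_).2 (hd .a) fun k =>
    ⟨k, hd _, k.2, fun t ht => hx.loc_eq_of_disabled (hd _) ht⟩
  rw [card_solo_add]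
  exact Nat.le_succ n

theorem HasLocalDeadlock.succ [Fintype QB] [Finite QA] [Finite IA] [Finite IB]
    (h : HasLocalDeadlock A B n) (hn : Fintype.card QB < n) : HasLocalDeadlock A B (n + 1) := by
  obtain ⟨x, t₀, P, hx, ⟨p, hp⟩, q, t, ht, hq⟩ := h.exists_lasso
  obtain ⟨j, hj⟩ := exists_not_solo A B x t₀ hn
  have : Nonempty {j // ¬ Solo A B x t₀ j} := ⟨⟨j, hj⟩⟩
  refine (hx.cover_exact.deadlock hx (m := n + 1) ?_).1 ?_ ?_
  · rw [card_solo_add]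
    exact Nat.le_succ n
  · cases q with
    | a => exact Or.inl ⟨t, ht, hq⟩
    | b i =>
      have hs : ¬ Stuck A B x t₀ (.b i) := fun hs => hx.proc_ne_of_disabled hs ht hq
      obtain ⟨s, hs'⟩ := hx.exact_live le_rfl hx.pos dvd_rfl hs
      exact Or.inr ⟨⟨i, fun h => hs h.1⟩, s, hs'⟩
  · cases p with
    | a => exact Or.inl hp
    | b d =>
      right
      by_cases hd : Solo A B x t₀ d
      · exact Or.inl ⟨d, hd⟩
      · exact Or.inr ⟨⟨d, hd⟩, d, hp, hd, fun t ht => hx.loc_eq_of_disabled hp ht⟩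

end Assembly

/-! ### Splicing traces, and relays that take turns in following one process -/

section Traces

variable {QA QB IA IB : Type*} {A : Template QA QB QA IA} {B : Template QA QB QB IB} {n m : ℕ}
  {x : ℕ → Config QA QB IA IB n} {t₀ P : ℕ}

open scoped Classical in
/-- Follow the first trace until time `T`, when it has just arrived in a state, and the second trace
afterwards. -/
noncomputable def Trace.splice (v w : Trace x) (T : ℕ) (hT : (v.z T).1 = (w.z T).1)
    (harr : T = 0 ∨ v.mv (T - 1)) : Trace x where
  z t := if t < T then v.z t else w.z t
  mv t := if t < T then v.mv t else w.mv t
  idle t ht := by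
    rcases lt_trichotomy (t + 1) T with h | h | h
    · have h' : t < T := by omega
      simp only [h, h', if_true] at ht ⊢
      exact v.idle t ht
    · have h' : t < T := by omega
      simp only [h', if_true] at ht
      -- Idling just before `T` is excluded, because the first trace arrives at `T` by a move.
      rcases harr with h0 | h0
      · omega
      · rw [← h] at h0
        exact absurd h0 ht
    · have h1 : ¬ t < T := by omega
      have h2 : ¬ t + 1 < T := by omega
      simp only [h1, h2, if_false] at ht ⊢
      exact w.idle t ht
  move t ht := by
    rcases lt_trichotomy (t + 1) T with h | h | h
    · have h' : t < T := by omega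
      simp only [h, h', if_true] at ht ⊢
      exact v.move t ht
    · have h' : t < T := by omega
      have h2 : ¬ t + 1 < T := by omega
      simp only [h', h2, if_true, if_false] at ht ⊢
      -- The move into time `T` ends with the input of the second trace. This is allowed because the
      -- input after a move is arbitrary.
      rw [h, ← hT, ← h]
      exact v.move t ht
    · have h1 : ¬ t < T := by omega
      have h2 : ¬ t + 1 < T := by omega
      simp only [h1, h2, if_false] at ht ⊢
      exact w.move t ht

section Splice

variable {v w : Trace x} {T : ℕ} {hT : (v.z T).1 = (w.z T).1} {harr : T = 0 ∨ v.mv (T - 1)}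

theorem Trace.splice_of_lt {t : ℕ} (ht : t < T) :
    (v.splice w T hT harr).z t = v.z t ∧ ((v.splice w T hT harr).mv t ↔ v.mv t) := by
  simp [Trace.splice, ht]

theorem Trace.splice_of_le {t : ℕ} (ht : T ≤ t) :
    (v.splice w T hT harr).z t = w.z t ∧ ((v.splice w T hT harr).mv t ↔ w.mv t) := by
  simp [Trace.splice, ht.not_gt]

theorem Trace.splice_init (hv : (v.z 0).1 = B.init) :
    ((v.splice w T hT harr).z 0).1 = B.init := by
  rcases Nat.eq_zero_or_pos T with h | h
  · rw [(splice_of_le h.le).1, ← hv]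
    subst h
    exact hT.symm
  · rw [(splice_of_lt h).1, hv]

end Splice

open scoped Classical in
/-- Follow the process `B_p` while `act` holds, and take the values of `fz` otherwise. -/
noncomputable def Lasso.follow (h : Lasso A B x t₀ P) (p : Fin n) (act : ℕ → Prop)
    (fz : ℕ → QB × IB) (h1 : ∀ t, act t → ¬ act (t + 1) → fz (t + 1) = loc x p (t + 1))
    (h2 : ∀ t, ¬ act t → act (t + 1) → loc x p (t + 1) = fz t)
    (h3 : ∀ t, ¬ act t → ¬ act (t + 1) → fz (t + 1) = fz t) : Trace x where
  z t := if act t then loc x p t else fz t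
  mv t := act t ∧ (x t).proc = some (.b p)
  idle t ht := by
    by_cases ha : act t <;> by_cases hb : act (t + 1)
    · simp only [ha, hb, if_true]
      exact h.loc_succ fun e => ht ⟨ha, e⟩
    · simp only [ha, hb, if_true, if_false]
      rw [h1 t ha hb]
      exact h.loc_succ fun e => ht ⟨ha, e⟩
    · simp only [ha, hb, if_true, if_false]
      exact h2 t ha hb
    · simp only [ha, hb, if_false]
      exact h3 t ha hb
  move t ht := by
    obtain ⟨ha, hp⟩ := ht
    refine ⟨p, hp, by simp [ha], ?_⟩
    by_cases hb : act (t + 1)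
    · simp [hb]
    · simp [hb, h1 t ha hb]

/-- The trace that stays where `B_p` is at time `L` until then, and follows `B_p` afterwards. -/
noncomputable def Lasso.hold (h : Lasso A B x t₀ P) (p : Fin n) (L : ℕ) : Trace x :=
  h.follow p (fun t => L ≤ t) (fun _ => loc x p L) (fun t h1 h2 => absurd h1 (by omega))
    (fun t h1 h2 => by rw [show t + 1 = L by omega]) fun _ _ _ => rfl

/-- The trace that never moves. -/
def Trace.const (x : ℕ → Config QA QB IA IB n) (q : QB × IB) : Trace x where
  z _ := q
  mv _ := False
  idle _ _ := rfl
  move _ h := h.elim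

/-- The phases of a relay of `K` traces, where the trace `c` follows the process `B_p` in the phases
that are congruent to `c` modulo `K`; `L k` is where `B_p` is when the phase `k` begins. -/
structure Clock (x : ℕ → Config QA QB IA IB n) (P : ℕ) (p : Fin n) (a K : ℕ) (φ : ℕ → ℕ)
    (L : ℕ → QB × IB) : Prop where
  two_or_three : K = 2 ∨ K = 3
  zero : ∀ t ≤ a, φ t = 0
  start : L 0 = loc x p a
  step : ∀ t ≥ a, φ (t + 1) = φ t ∨ φ (t + 1) = φ t + 1 ∧ loc x p (t + 1) = L (φ t + 1)
  periodic : ∀ k, L (k + (K - 1)) = L k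
  mem : ∀ k, ∃ t ≥ a, L k = loc x p t
  advance : ∀ t ≥ a, φ (t + P) = φ t + (K - 1)

section Relay

variable {p : Fin n} {a K c : ℕ} {φ : ℕ → ℕ} {L : ℕ → QB × IB}

/-- The trace `c` of a relay. -/
noncomputable def Lasso.relay (h : Lasso A B x t₀ P) (C : Clock x P p a K φ L) (hc : c < K) :
    Trace x :=
  -- While it does not follow `B_p`, the trace waits where its next phase begins; `(c + K - φ t % K)
  -- % K` counts the phases until then.
  h.follow p (fun t => a ≤ t ∧ φ t % K = c) (fun t => L (φ t + (c + K - φ t % K) % K))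
    (by
      rintro t ⟨ha, h1⟩ h2
      have h2 : φ (t + 1) % K ≠ c := fun e => h2 ⟨by omega, e⟩
      rcases C.step t ha with he | ⟨he, hl⟩
      · rw [he] at h2
        exact absurd h1 h2
      · rw [hl, ← C.periodic (φ t + 1), he]
        congr 1
        rcases C.two_or_three with rfl | rfl <;> omega)
    (by
      rintro t h1 ⟨ha, h2⟩
      rcases lt_or_ge t a with hta | hta
      · obtain rfl : t + 1 = a := by omega
        rw [C.zero _ le_rfl] at h2
        rw [C.zero t hta.le, ← C.start]
        congr 1
        rcases C.two_or_three with rfl | rfl <;> omega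
      · have h1 : φ t % K ≠ c := fun e => h1 ⟨hta, e⟩
        rcases C.step t hta with he | ⟨he, hl⟩
        · rw [he] at h2
          exact absurd h2 h1
        · rw [hl]
          rw [he] at h2
          congr 1
          rcases C.two_or_three with rfl | rfl <;> omega)
    (by
      intro t h1 h2
      rcases lt_or_ge t a with hta | hta
      · rw [C.zero t hta.le, C.zero (t + 1) hta]
      · have h1 : φ t % K ≠ c := fun e => h1 ⟨hta, e⟩
        have h2 : φ (t + 1) % K ≠ c := fun e => h2 ⟨by omega, e⟩
        rcases C.step t hta with he | ⟨he, hl⟩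
        · rw [he]
        · rw [he] at h2 ⊢
          congr 1
          rcases C.two_or_three with rfl | rfl <;> omega)

theorem Lasso.relay_z_of_le (h : Lasso A B x t₀ P) (C : Clock x P p a K φ L) (hc : c < K) {t : ℕ}
    (ht : t ≤ a) : (h.relay C hc).z t = L c := by
  have hz := C.zero t ht
  have : (c + K - 0 % K) % K = c := by rcases C.two_or_three with rfl | rfl <;> omega
  simp only [Lasso.relay, Lasso.follow, hz, zero_add, this]
  split_ifs with h1
  · obtain ⟨h1, h2⟩ := h1
    obtain rfl : t = a := by omega
    rw [← C.start]
    congr 1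
  · rfl

theorem Lasso.relay_idle (h : Lasso A B x t₀ P) (C : Clock x P p a K φ L) (hc : c < K) {t : ℕ}
    (ht : φ t % K ≠ c) :
    ¬ (h.relay C hc).mv t ∧ (h.relay C hc).z t = L (φ t + (c + K - φ t % K) % K) := by
  simp [Lasso.relay, Lasso.follow, ht]

theorem Lasso.relay_not_mv_of_lt (h : Lasso A B x t₀ P) (C : Clock x P p a K φ L) (hc : c < K)
    {t : ℕ} (ht : t < a) : ¬ (h.relay C hc).mv t := by
  simp [Lasso.relay, Lasso.follow, ht]

theorem Lasso.relay_mem (h : Lasso A B x t₀ P) (C : Clock x P p a K φ L) (hc : c < K) (t : ℕ) :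
    ∃ t' ≥ a, (h.relay C hc).z t = loc x p t' := by
  simp only [Lasso.relay, Lasso.follow]
  split_ifs with h1
  · exact ⟨t, h1.1, rfl⟩
  · exact C.mem _

theorem Clock.periodic_six (C : Clock x P p a K φ L) (k : ℕ) : L (k + 6 * (K - 1)) = L k := by
  have h : ∀ i, L (k + i * (K - 1)) = L k := by
    intro i
    induction i with
    | zero => simp
    | succ i ih => rw [Nat.succ_mul, ← add_assoc, C.periodic, ih]
  exact h 6

theorem Clock.advance_mul (C : Clock x P p a K φ L) {t : ℕ} (ht : a ≤ t) (i : ℕ) :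
    φ (t + i * P) = φ t + i * (K - 1) := by
  induction i with
  | zero => simp
  | succ i ih => rw [Nat.succ_mul, ← add_assoc, C.advance _ (by omega), ih, Nat.succ_mul, add_assoc]

/-- In time `6 * P` the phase advances by `6 * (K - 1)`, a multiple of `K` for `K = 2` and for `K =
3`. -/
theorem Lasso.relay_periodic (h : Lasso A B x t₀ P) (C : Clock x P p a K φ L) (hc : c < K)
    (ha : t₀ ≤ a) {t : ℕ} (ht : a ≤ t) :
    (h.relay C hc).z (t + 6 * P) = (h.relay C hc).z t := by
  have h1 := C.advance_mul ht 6
  have h2 : (φ t + 6 * (K - 1)) % K = φ t % K := by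
    rcases C.two_or_three with rfl | rfl <;> omega
  have h3 : ∀ i, L (φ t + 6 * (K - 1) + i) = L (φ t + i) := fun i => by
    rw [add_right_comm, C.periodic_six]
  have h4 : a ≤ t + 6 * P := by omega
  simp only [Lasso.relay, Lasso.follow, h1, h2, h3, h.loc_periodic (Dvd.intro_left 6 rfl) p
    (ha.trans ht), ht, h4, true_and]

theorem Lasso.relay_live (h : Lasso A B x t₀ P) (C : Clock x P p a K φ L) (hc : c < K)
    (hp : ¬ Stuck A B x t₀ (.b p)) (ha : t₀ ≤ a) {tw : ℕ} (htw : a ≤ tw) :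
    ∃ t, tw ≤ t ∧ t < tw + 6 * P ∧ (h.relay C hc).mv t := by
  obtain ⟨t, h1, h2, h3⟩ := h.exact_live (ha.trans htw) h.pos dvd_rfl hp
  -- One period changes the phase by `K - 1`, that is by `-1` modulo `K`, so that within `K` periods
  -- each trace has its turn at a given move of `B_p`.
  have hi : ∃ i < 3, (φ t + i * (K - 1)) % K = c := by
    rcases C.two_or_three with rfl | rfl
    · exact ⟨(φ t + c) % 2, by omega, by omega⟩
    · exact ⟨(φ t + 2 * c) % 3, by omega, by omega⟩
  obtain ⟨i, hi, hic⟩ := hi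
  have hiP : i * P ≤ 2 * P := Nat.mul_le_mul_right _ (by omega)
  refine ⟨t + i * P, by omega, by omega, ⟨by omega, ?_⟩, ?_⟩
  · rw [C.advance_mul (by omega), hic]
  · rw [mul_comm, h.periodic_mul (by omega)]
    exact h3

/-- Each phase is one period, at whose ends `B_p` is back where it was at time `a`. While one trace
follows, its partner waits there. -/
theorem Lasso.clock_two (h : Lasso A B x t₀ P) (p : Fin n) {a : ℕ} (ha : t₀ ≤ a) :
    Clock x P p a 2 (fun t => (t - a) / P) fun _ => loc x p a where
  two_or_three := Or.inl rfl
  zero t ht := by simp [Nat.sub_eq_zero_of_le ht]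
  start := rfl
  step t ht := by
    rw [show t + 1 - a = t - a + 1 by omega, Nat.succ_div]
    split_ifs with hd
    · right
      refine ⟨rfl, ?_⟩
      obtain ⟨k, hk⟩ := hd
      rw [show t + 1 = a + P * k by omega]
      exact h.loc_periodic (Dvd.intro _ rfl) p ha
    · exact Or.inl rfl
  periodic _ := rfl
  mem _ := ⟨a, le_rfl, rfl⟩
  advance t ht := by
    rw [show t + P - a = t - a + P by omega, Nat.add_div_right _ h.pos]

/-- Each period has two phases, from the position at time `a` to that at time `a + δ`, and back. Of
three traces the two idle ones wait for the next phase and for the one after it, hence at both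
positions: three traces do the work of two pairs. -/
theorem Lasso.clock_three (h : Lasso A B x t₀ P) (p : Fin n) {a δ : ℕ} (ha : t₀ ≤ a) (hδ : 0 < δ)
    (hδP : δ < P) :
    Clock x P p a 3 (fun t => 2 * ((t - a) / P) + if δ ≤ (t - a) % P then 1 else 0)
      fun k => if k % 2 = 0 then loc x p a else loc x p (a + δ) where
  two_or_three := Or.inr rfl
  zero t ht := by simp [Nat.sub_eq_zero_of_le ht, hδ.ne']
  start := rfl
  step t ht := by
    simp only [show t + 1 - a = t - a + 1 by omega]
    have h0 := Nat.div_add_mod (t - a) P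
    have hlt := Nat.mod_lt (t - a) h.pos
    generalize (t - a) / P = q at *
    generalize (t - a) % P = s at *
    rcases Nat.lt_or_ge (s + 1) P with hs | hs
    · have e1 : (t - a + 1) / P = q := by
        rw [← h0, add_assoc, Nat.mul_add_div h.pos, Nat.div_eq_of_lt hs, add_zero]
      have e2 : (t - a + 1) % P = s + 1 := by
        rw [← h0, add_assoc, Nat.mul_add_mod, Nat.mod_eq_of_lt hs]
      rw [e1, e2]
      rcases Nat.lt_trichotomy (s + 1) δ with h1 | h1 | h1
      · left
        rw [if_neg (by omega), if_neg (by omega)]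
      · right
        rw [if_pos (by omega), if_neg (by omega)]
        refine ⟨rfl, ?_⟩
        rw [if_neg (by omega), show t + 1 = a + δ + P * q by omega]
        exact h.loc_periodic (Dvd.intro _ rfl) p (by omega)
      · left
        rw [if_pos (by omega), if_pos (by omega)]
    · have hs : s + 1 = P := by omega
      have e0 : t - a + 1 = P * (q + 1) := by rw [Nat.mul_succ]; omega
      have e1 : (t - a + 1) / P = q + 1 := by rw [e0, Nat.mul_div_cancel_left _ h.pos]
      have e2 : (t - a + 1) % P = 0 := by rw [e0, Nat.mul_mod_right]
      rw [e1, e2]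
      right
      rw [if_neg (by omega), if_pos (by omega)]
      refine ⟨rfl, ?_⟩
      rw [if_pos (by omega), show t + 1 = a + P * (q + 1) by omega]
      exact h.loc_periodic (Dvd.intro _ rfl) p ha
  periodic k := by
    rw [show (k + (3 - 1)) % 2 = k % 2 by omega]
  mem k := by
    by_cases hk : k % 2 = 0
    · exact ⟨a, le_rfl, by simp [hk]⟩
    · exact ⟨a + δ, by omega, by simp [hk]⟩
  advance t ht := by
    simp only [show t + P - a = t - a + P by omega, Nat.add_div_right _ h.pos, Nat.add_mod_right]
    omega

end Relay

end Traces

/-! ### Flooding visited states and evacuating those that are not recurrent -/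

section Flooding

variable {QA QB IA IB : Type*} {A : Template QA QB QA IA} {B : Template QA QB QB IB} {n m : ℕ}
  {x : ℕ → Config QA QB IA IB n} {t₀ P : ℕ}

variable (A B) in
/-- Some process that is not solo visits `r`. -/
def Visits (x : ℕ → Config QA QB IA IB n) (t₀ : ℕ) (r : QB) (t : ℕ) : Prop :=
  ∃ j, ¬ Solo A B x t₀ j ∧ (loc x j t).1 = r

variable (A B) in
/-- The states that are visited by processes that are not solo. -/
def visited (x : ℕ → Config QA QB IA IB n) (t₀ : ℕ) : Set QB :=
  {r | ∃ t, Visits A B x t₀ r t}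

variable (A B) in
/-- The states that are visited from time `t₀` on by processes that are not solo. -/
def recurrent (x : ℕ → Config QA QB IA IB n) (t₀ : ℕ) : Set QB :=
  {r | ∃ t ≥ t₀, Visits A B x t₀ r t}

/-- The trace idles in state `r` at time `t`. -/
def IdleAt (ζ : Trace x) (t : ℕ) (r : QB) : Prop := ¬ ζ.mv t ∧ (ζ.z t).1 = r

theorem recurrent_subset_visited : recurrent A B x t₀ ⊆ visited A B x t₀ :=
  fun _ ⟨t, _, ht⟩ => ⟨t, ht⟩

/-- The first visitor is there initially or has just arrived by a move. In both cases its input is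
free, which is what `Trace.splice` needs to let the copy stay behind. -/
theorem Lasso.exists_first (h : Lasso A B x t₀ P) {r : QB} (hr : r ∈ visited A B x t₀) :
    ∃ f T, ((h.exact f).z T).1 = r ∧ ¬ Solo A B x t₀ f ∧ (T = 0 ∨ (h.exact f).mv (T - 1)) ∧
      ∀ t, Visits A B x t₀ r t → T ≤ t := by
  classical
  have hr : ∃ t, Visits A B x t₀ r t := hr
  obtain ⟨f, hf, hT⟩ := Nat.find_spec hr
  refine ⟨f, Nat.find hr, hT, hf, ?_, fun t ht => Nat.find_min' hr ht⟩
  rcases Nat.eq_zero_or_pos (Nat.find hr) with h0 | h0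
  · exact Or.inl h0
  · right
    by_contra hmv
    have := h.loc_succ (t := Nat.find hr - 1) hmv
    rw [Nat.sub_add_cancel h0] at this
    exact Nat.find_min hr (m := Nat.find hr - 1) (by omega) ⟨f, hf, by rw [← this, hT]⟩

/-- A trace that floods `r` until time `s`, and then follows a given trace. -/
theorem Lasso.exists_flood (h : Lasso A B x t₀ P) {r : QB} {w : Trace x} {s : ℕ}
    (hr : ∃ t ≤ s, Visits A B x t₀ r t) (hw : ∀ t ≤ s, (w.z t).1 = r) (hw' : ∀ t < s, ¬ w.mv t) :
    ∃ ζ : Trace x, (ζ.z 0).1 = B.init ∧ (∀ t ≥ s, ζ.z t = w.z t ∧ (ζ.mv t ↔ w.mv t)) ∧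
      ∀ t < s, Visits A B x t₀ r t → IdleAt ζ t r := by
  obtain ⟨t₁, ht₁, hv₁⟩ := hr
  obtain ⟨f, T, hT, -, harr, hmin⟩ := h.exists_first ⟨t₁, hv₁⟩
  have hTs : T ≤ s := (hmin _ hv₁).trans ht₁
  refine ⟨(h.exact f).splice w T (hT.trans (hw T hTs).symm) harr,
    Trace.splice_init (h.loc_init f), fun t ht => Trace.splice_of_le (by omega), ?_⟩
  intro t ht hv
  have hTt := hmin t hv
  refine ⟨?_, ?_⟩
  · rw [(Trace.splice_of_le hTt).2]
    exact hw' t ht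
  · rw [(Trace.splice_of_le hTt).1]
    exact hw t ht.le

/-- Flooding with evacuation: a trace that stays in `r` as long as other processes need it there, and
then follows the last process that leaves. -/
theorem Lasso.exists_evac (h : Lasso A B x t₀ P) {r : QB} (hr : r ∈ visited A B x t₀)
    (hr' : r ∉ recurrent A B x t₀) :
    ∃ (ζ : Trace x) (l : Fin n) (L : ℕ), ¬ Solo A B x t₀ l ∧ (loc x l L).1 = r ∧ L < t₀ ∧
      (ζ.z 0).1 = B.init ∧
      (∀ t ≥ L, ζ.z t = loc x l t ∧ (ζ.mv t ↔ (x t).proc = some (.b l))) ∧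
      (∀ t, Visits A B x t₀ r t → t ≤ L) ∧
      ∀ t j, ¬ Solo A B x t₀ j → (x t).proc ≠ some (.b j) → (loc x j t).1 = r → IdleAt ζ t r := by
  classical
  obtain ⟨t₁, hv₁⟩ := hr
  have hlt : ∀ t, Visits A B x t₀ r t → t < t₀ := by
    intro t ht
    by_contra hcon
    exact hr' ⟨t, not_lt.1 hcon, ht⟩
  set L := Nat.findGreatest (Visits A B x t₀ r) t₀ with hL
  obtain ⟨l, hl, hlL⟩ : Visits A B x t₀ r L :=
    Nat.findGreatest_spec (hlt _ hv₁).le hv₁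
  have hmax : ∀ t, Visits A B x t₀ r t → t ≤ L := fun t ht => Nat.le_findGreatest (hlt t ht).le ht
  have hw : ∀ t ≤ L, ((h.hold l L).z t).1 = r := by
    intro t ht
    simp only [Lasso.hold, Lasso.follow]
    split_ifs with h1
    · obtain rfl : t = L := by omega
      exact hlL
    · exact hlL
  obtain ⟨ζ, h1, h2, h3⟩ := h.exists_flood (w := h.hold l L) (s := L) ⟨L, le_rfl, l, hl, hlL⟩ hw
    (fun t ht => by simp [Lasso.hold, Lasso.follow, ht])
  refine ⟨ζ, l, L, hl, hlL, hlt L ⟨l, hl, hlL⟩, h1, fun t ht => ?_, hmax,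
    fun t j hj hp hjr => ?_⟩
  · rw [(h2 t ht).1, (h2 t ht).2]
    simp [Lasso.hold, Lasso.follow, ht]
  · refine h3 t ?_ ⟨j, hj, hjr⟩
    -- A process that does not move is still in `r` at time `t + 1`, so `t < L`: at time `L` itself
    -- nobody needs support in `r`.
    have := hmax (t + 1) ⟨j, hj, by rw [h.loc_succ hp, hjr]⟩
    omega

variable (A B) in
/-- Traces that take care of the recurrent states: early on, each such state is flooded by one of
them, and from time `s` on they keep these states flooded together. -/
structure Core {κ : Type*} (x : ℕ → Config QA QB IA IB n) (t₀ P : ℕ) (ζ : κ → Trace x)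
    (s tw Q : ℕ) : Prop where
  le : t₀ ≤ s
  le' : s ≤ tw
  pos : 0 < Q
  dvd : P ∣ Q
  init : ∀ k, ((ζ k).z 0).1 = B.init
  early : ∀ r ∈ recurrent A B x t₀, ∃ k, ∀ t < s, Visits A B x t₀ r t → IdleAt (ζ k) t r
  late : ∀ r ∈ recurrent A B x t₀, ∀ t ≥ s, ∃ k, IdleAt (ζ k) t r
  periodic : ∀ k, (ζ k).z (tw + Q) = (ζ k).z tw
  tail : ∀ k, ∀ t ≥ tw, ∃ j, ¬ Solo A B x t₀ j ∧ ∃ t' ≥ t₀, ((ζ k).z t).1 = (loc x j t').1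
  live_or_dead : ∀ k, (∃ t, tw ≤ t ∧ t < tw + Q ∧ (ζ k).mv t) ∨ DeadTrace A B x t₀ tw (ζ k)

/-- The states that are not recurrent can be taken care of by evacuation. -/
theorem Core.exists_cover {κ : Type*} {ζ : κ → Trace x} {s tw Q : ℕ}
    (C : Core A B x t₀ P ζ s tw Q) (h : Lasso A B x t₀ P) (F : Set QB)
    (hF : F ⊆ visited A B x t₀ \ recurrent A B x t₀)
    (hF' : ∀ r ∈ visited A B x t₀, r ∉ recurrent A B x t₀ → r ∉ F → ∃ k, ∀ t j,
      ¬ Solo A B x t₀ j → (x t).proc ≠ some (.b j) → (loc x j t).1 = r → IdleAt (ζ k) t r) :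
    ∃ ξ : κ ⊕ F → Trace x, Cover A B x t₀ P ξ tw Q ∧ ∀ k, ξ (.inl k) = ζ k := by
  have hev : ∀ r : F, ∃ (ζ : Trace x) (l : Fin n), ¬ Solo A B x t₀ l ∧ (ζ.z 0).1 = B.init ∧
      (∀ t ≥ t₀, ζ.z t = loc x l t ∧ (ζ.mv t ↔ (x t).proc = some (.b l))) ∧
      ∀ t j, ¬ Solo A B x t₀ j → (x t).proc ≠ some (.b j) → (loc x j t).1 = r →
        IdleAt ζ t r := by
    intro r
    obtain ⟨ζ, l, L, h1, -, h2, h3, h4, -, h5⟩ := h.exists_evac (hF r.2).1 (hF r.2).2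
    exact ⟨ζ, l, h1, h3, fun t ht => h4 t (by omega), h5⟩
  choose η l hl hinit hlate hidle using hev
  have htw := C.le.trans C.le'
  refine ⟨Sum.elim ζ η, ⟨htw, C.pos, C.dvd, ?_, ?_, ?_, ?_, ?_⟩, fun k => rfl⟩
  · rintro (k | r)
    · exact C.init k
    · exact hinit r
  · intro t j hj hp
    by_cases hr : (loc x j t).1 ∈ recurrent A B x t₀
    · rcases lt_or_ge t s with hts | hts
      · obtain ⟨k, hk⟩ := C.early _ hr
        exact ⟨.inl k, hk t hts ⟨j, hj, rfl⟩⟩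
      · obtain ⟨k, hk⟩ := C.late _ hr t hts
        exact ⟨.inl k, hk⟩
    · by_cases hrF : (loc x j t).1 ∈ F
      · exact ⟨.inr ⟨_, hrF⟩, hidle ⟨_, hrF⟩ t j hj hp rfl⟩
      · obtain ⟨k, hk⟩ := hF' _ ⟨t, j, hj, rfl⟩ hr hrF
        exact ⟨.inl k, hk t j hj hp rfl⟩
  · rintro (k | r)
    · exact C.periodic k
    · simp only [Sum.elim_inr, (hlate r tw htw).1, (hlate r (tw + Q) (by omega)).1]
      exact h.loc_periodic C.dvd _ htw
  · rintro (k | r) t ht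
    · exact C.tail k t ht
    · exact ⟨l r, hl r, t, htw.trans ht, by rw [Sum.elim_inr, (hlate r t (htw.trans ht)).1]⟩
  · rintro (k | r)
    · exact C.live_or_dead k
    · by_cases hs : Stuck A B x t₀ (.b (l r))
      · refine Or.inr ⟨l r, hs, hl r, fun t ht => ?_⟩
        rw [Sum.elim_inr, (hlate r t (htw.trans ht)).1, h.loc_eq_of_disabled hs (htw.trans ht)]
      · obtain ⟨t, h1, h2, h3⟩ := h.exact_live htw C.pos C.dvd hs
        exact Or.inl ⟨t, h1, h2, (hlate r t (htw.trans h1)).2.2 h3⟩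

end Flooding

/-! ### One copy for each recurrent state, and a second one where it is needed -/

section Pairs

variable {QA QB IA IB : Type*} {A : Template QA QB QA IA} {B : Template QA QB QB IB} {n m : ℕ}
  {x : ℕ → Config QA QB IA IB n} {t₀ P : ℕ}

/-- The two traces agree from time `s` on. -/
def AgreeFrom (s : ℕ) (ζ w : Trace x) : Prop := ∀ t ≥ s, ζ.z t = w.z t ∧ (ζ.mv t ↔ w.mv t)

theorem AgreeFrom.idleAt {s : ℕ} {ζ w : Trace x} (h : AgreeFrom s ζ w) {t : ℕ} (ht : s ≤ t)
    {r : QB} (hw : IdleAt w t r) : IdleAt ζ t r :=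
  ⟨fun hm => hw.1 ((h t ht).2.1 hm), by rw [(h t ht).1, hw.2]⟩

theorem Lasso.exists_visits_le (h : Lasso A B x t₀ P) {s : ℕ} (hs : t₀ + P ≤ s) {r : QB}
    (hr : r ∈ recurrent A B x t₀) : ∃ t ≤ s, Visits A B x t₀ r t := by
  obtain ⟨t, ht, j, hj, hr⟩ := hr
  obtain ⟨t', -, h2, h3⟩ := h.exists_shift ht le_rfl
  exact ⟨t', by omega, j, hj, by simp only [loc, h3]; exact hr⟩

theorem Lasso.exists_loc_eq (h : Lasso A B x t₀ P) {p : Fin n} {r : QB} {t : ℕ} (ht : t₀ ≤ t)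
    (hr : (loc x p t).1 = r) {s : ℕ} (hs : t₀ ≤ s) :
    ∃ a, s ≤ a ∧ a < s + P ∧ (loc x p a).1 = r := by
  obtain ⟨a, h1, h2, h3⟩ := h.exists_shift ht hs
  exact ⟨a, h1, h2, by simp only [loc, h3]; exact hr⟩

theorem not_solo_of_not_stuck {p : Fin n} (hp : ¬ Stuck A B x t₀ (.b p)) :
    ¬ Solo A B x t₀ p := fun h => hp h.1

/-- What a relay contributes to a `Core`. -/
theorem Lasso.relay_core (h : Lasso A B x t₀ P) {p : Fin n} {a K c s tw : ℕ} {φ : ℕ → ℕ}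
    {L : ℕ → QB × IB} (C : Clock x P p a K φ L) (hc : c < K) (hp : ¬ Stuck A B x t₀ (.b p))
    (ha : t₀ ≤ a) (hs : s ≤ tw) (hatw : a ≤ tw) {ζ : Trace x}
    (hζ : AgreeFrom s ζ (h.relay C hc)) :
    ζ.z (tw + 6 * P) = ζ.z tw ∧
    (∀ t ≥ tw, ∃ j, ¬ Solo A B x t₀ j ∧ ∃ t' ≥ t₀, (ζ.z t).1 = (loc x j t').1) ∧
    ∃ t, tw ≤ t ∧ t < tw + 6 * P ∧ ζ.mv t := by
  refine ⟨?_, fun t ht => ?_, ?_⟩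
  · rw [(hζ tw hs).1, (hζ (tw + 6 * P) (by omega)).1, h.relay_periodic C hc ha hatw]
  · obtain ⟨t', ht', he⟩ := h.relay_mem C hc t
    exact ⟨p, not_solo_of_not_stuck hp, t', ha.trans ht', by rw [(hζ t (by omega)).1, he]⟩
  · obtain ⟨t, h1, h2, h3⟩ := h.relay_live C hc hp ha hatw
    exact ⟨t, h1, h2, (hζ t (by omega)).2.2 h3⟩

variable (A B) in
/-- The states where a disabled process sits that is not solo. -/
def deadStates (x : ℕ → Config QA QB IA IB n) (t₀ : ℕ) : Set QB :=
  {r | ∃ d, Stuck A B x t₀ (.b d) ∧ ¬ Solo A B x t₀ d ∧ (loc x d t₀).1 = r}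

variable (A B) in
/-- The states that are visited from time `t₀` on by processes that keep moving. -/
def liveStates (x : ℕ → Config QA QB IA IB n) (t₀ : ℕ) : Set QB :=
  {r | ∃ p, ¬ Stuck A B x t₀ (.b p) ∧ ∃ t ≥ t₀, (loc x p t).1 = r}

theorem liveStates_subset : liveStates A B x t₀ ⊆ recurrent A B x t₀ :=
  fun _ ⟨p, hp, t, ht, hr⟩ => ⟨t, ht, p, not_solo_of_not_stuck hp, hr⟩

theorem deadStates_subset : deadStates A B x t₀ ⊆ recurrent A B x t₀ :=
  fun _ ⟨d, _, hd, hr⟩ => ⟨t₀, le_rfl, d, hd, hr⟩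

theorem Lasso.recurrent_subset (h : Lasso A B x t₀ P) :
    recurrent A B x t₀ ⊆ deadStates A B x t₀ ∪ liveStates A B x t₀ := by
  rintro r ⟨t, ht, j, hj, hr⟩
  by_cases hs : Stuck A B x t₀ (.b j)
  · exact Or.inl ⟨j, hs, hj, by rw [← h.loc_eq_of_disabled hs ht, hr]⟩
  · exact Or.inr ⟨j, hs, t, ht, hr⟩

/-- One trace for each recurrent state, and an additional trace for each state in `E`. The beginning
of the additional traces is arbitrary. -/
theorem Lasso.exists_core_pairs (h : Lasso A B x t₀ P) {s : ℕ} (hs : t₀ + P ≤ s) {E : Set QB}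
    (hE : E ⊆ liveStates A B x t₀) (hE' : recurrent A B x t₀ ⊆ deadStates A B x t₀ ∪ E)
    (X : E → Trace x → Prop)
    (hX : ∀ (r : E) (w : Trace x), (∀ t ≤ s, (w.z t).1 = r) → (∀ t < s, ¬ w.mv t) →
      ∃ ζ : Trace x, (ζ.z 0).1 = B.init ∧ AgreeFrom s ζ w ∧ X r ζ) :
    ∃ ζ : recurrent A B x t₀ ⊕ E → Trace x, Core A B x t₀ P ζ s (s + P) (6 * P) ∧
      (∀ r, X r (ζ (.inr r))) ∧
      (∀ r, ∃ t, s + P ≤ t ∧ t < s + P + 6 * P ∧ (ζ (.inr r)).mv t) ∧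
      ∀ r : recurrent A B x t₀, (r : QB) ∈ deadStates A B x t₀ →
        DeadTrace A B x t₀ (s + P) (ζ (.inl r)) := by
  have hP := h.pos
  have hEa : ∀ r : E, ∃ p, ¬ Stuck A B x t₀ (.b p) ∧ ∃ a, s ≤ a ∧ a < s + P ∧
      (loc x p a).1 = r := by
    intro r
    obtain ⟨p, hp, t, ht, hr⟩ := hE r.2
    exact ⟨p, hp, h.exists_loc_eq ht hr (by omega)⟩
  choose p hp a ha ha' har using hEa
  have hc := fun r : E => h.clock_two (p r) (show t₀ ≤ a r by have := ha r; omega)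
  have h1 : ∀ r : E, ∃ ζ : Trace x, (ζ.z 0).1 = B.init ∧
      AgreeFrom s ζ (h.relay (hc r) one_lt_two) ∧ X r ζ := by
    intro r
    refine hX r _ (fun t ht => ?_) fun t ht =>
      h.relay_not_mv_of_lt (hc r) one_lt_two (ht.trans_le (ha r))
    rw [h.relay_z_of_le (hc r) one_lt_two (ht.trans (ha r)), har]
  choose ζ₁ hinit₁ hagree₁ hX₁ using h1
  -- A state where a non-solo process is stuck gets a copy frozen like that process. Any other
  -- recurrent state lies in `E`, and its copy takes role 0 in the relay in which the additional
  -- copy has role 1.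
  have h0 : ∀ r : recurrent A B x t₀, ∃ ζ : Trace x, (ζ.z 0).1 = B.init ∧
      (∀ t < s, Visits A B x t₀ r t → IdleAt ζ t r) ∧
      ((∃ d, Stuck A B x t₀ (.b d) ∧ ¬ Solo A B x t₀ d ∧ (loc x d t₀).1 = r ∧
          ∀ t ≥ s, ¬ ζ.mv t ∧ ζ.z t = loc x d t₀) ∨
        (r : QB) ∉ deadStates A B x t₀ ∧
          ∃ hr : (r : QB) ∈ E, AgreeFrom s ζ (h.relay (hc ⟨r, hr⟩) two_pos)) := by
    intro r
    have hvis := h.exists_visits_le hs r.2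
    by_cases hd : (r : QB) ∈ deadStates A B x t₀
    · obtain ⟨d, hd1, hd2, hd3⟩ := hd
      obtain ⟨ζ, e1, e2, e3⟩ := h.exists_flood (w := Trace.const x (loc x d t₀)) hvis
        (fun t _ => hd3) (fun t _ => id)
      refine ⟨ζ, e1, e3, Or.inl ⟨d, hd1, hd2, hd3, fun t ht => ⟨?_, (e2 t ht).1⟩⟩⟩
      rw [(e2 t ht).2]
      exact id
    · have hrE : (r : QB) ∈ E := (hE' r.2).resolve_left hd
      obtain ⟨ζ, e1, e2, e3⟩ := h.exists_flood (w := h.relay (hc ⟨r, hrE⟩) two_pos) hvis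
        (fun t ht => by
          rw [h.relay_z_of_le (hc ⟨r, hrE⟩) two_pos (ht.trans (ha _)), har])
        (fun t ht => h.relay_not_mv_of_lt _ _ (ht.trans_le (ha _)))
      exact ⟨ζ, e1, e3, Or.inr ⟨hd, hrE, e2⟩⟩
  choose ζ₀ hinit₀ hearly₀ hlate₀ using h0
  have hcore₁ := fun r : E => h.relay_core (tw := s + P) (hc r) one_lt_two (hp r)
    (by have := ha r; omega) (Nat.le_add_right _ _) (ha' r).le (hagree₁ r)
  have hcore₀ : ∀ r : recurrent A B x t₀,
      DeadTrace A B x t₀ (s + P) (ζ₀ r) ∧ (∀ t ≥ s, IdleAt (ζ₀ r) t r) ∨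
      (r : QB) ∉ deadStates A B x t₀ ∧
      ∃ hr : (r : QB) ∈ E, AgreeFrom s (ζ₀ r) (h.relay (hc ⟨r, hr⟩) two_pos) := by
    intro r
    refine (hlate₀ r).imp_left ?_
    rintro ⟨d, hd1, hd2, hd3, hd4⟩
    exact ⟨⟨d, hd1, hd2, fun t ht => (hd4 t (by omega)).2⟩,
      fun t ht => ⟨(hd4 t ht).1, by rw [(hd4 t ht).2, hd3]⟩⟩
  have hrelay₀ := fun (r : recurrent A B x t₀) (hr : (r : QB) ∈ E)
    (hag : AgreeFrom s (ζ₀ r) (h.relay (hc ⟨r, hr⟩) two_pos)) =>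
      h.relay_core (tw := s + P) (hc ⟨r, hr⟩) two_pos (hp _)
        (by have := ha ⟨r, hr⟩; omega) (Nat.le_add_right _ _) (ha' _).le hag
  refine ⟨Sum.elim ζ₀ ζ₁, ⟨by omega, Nat.le_add_right _ _, by omega, Dvd.intro_left 6 rfl,
    ?_, ?_, ?_, ?_, ?_, ?_⟩, hX₁, fun r => (hcore₁ r).2.2, ?_⟩
  · rintro (r | r)
    · exact hinit₀ r
    · exact hinit₁ r
  · exact fun r hr => ⟨.inl ⟨r, hr⟩, hearly₀ ⟨r, hr⟩⟩
  · intro r hr t ht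
    rcases hcore₀ ⟨r, hr⟩ with ⟨-, hi⟩ | ⟨-, hrE, hag⟩
    · exact ⟨.inl ⟨r, hr⟩, hi t ht⟩
    · by_cases hφ : (t - a ⟨r, hrE⟩) / P % 2 = 0
      · refine ⟨.inr ⟨r, hrE⟩, (hagree₁ _).idleAt ht ?_⟩
        obtain ⟨e1, e2⟩ := h.relay_idle (hc ⟨r, hrE⟩) one_lt_two (t := t) (by omega)
        exact ⟨e1, by rw [e2]; exact har ⟨r, hrE⟩⟩
      · refine ⟨.inl ⟨r, hr⟩, hag.idleAt ht ?_⟩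
        obtain ⟨e1, e2⟩ := h.relay_idle (hc ⟨r, hrE⟩) two_pos (t := t) (by omega)
        exact ⟨e1, by rw [e2]; exact har ⟨r, hrE⟩⟩
  · rintro (r | r)
    · rcases hcore₀ r with ⟨⟨d, hd1, hd2, hd3⟩, -⟩ | ⟨-, hrE, hag⟩
      · simp only [Sum.elim_inl, hd3 (s + P) le_rfl, hd3 (s + P + 6 * P) (by omega)]
      · exact (hrelay₀ r hrE hag).1
    · exact (hcore₁ r).1
  · rintro (r | r)
    · rcases hcore₀ r with ⟨⟨d, hd1, hd2, hd3⟩, -⟩ | ⟨-, hrE, hag⟩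
      · exact fun t ht => ⟨d, hd2, t₀, le_rfl, by rw [Sum.elim_inl, hd3 t ht]⟩
      · exact (hrelay₀ r hrE hag).2.1
    · exact (hcore₁ r).2.1
  · rintro (r | r)
    · rcases hcore₀ r with ⟨hd, -⟩ | ⟨-, hrE, hag⟩
      · exact Or.inr hd
      · exact Or.inl (hrelay₀ r hrE hag).2.2
    · exact Or.inl (hcore₁ r).2.2
  · intro r hr
    exact ((hcore₀ r).resolve_right fun h => h.1 hr).1

/-- Evacuation from a state that is not recurrent into a recurrent one. -/
theorem Lasso.exists_evac_into (h : Lasso A B x t₀ P) {q : QB} (hq : q ∈ visited A B x t₀)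
    (hq' : q ∉ recurrent A B x t₀) {s : ℕ} (hs : t₀ ≤ s) :
    ∃ r ∈ recurrent A B x t₀, ∀ w : Trace x, (∀ t ≤ s, (w.z t).1 = r) →
      ∃ ζ : Trace x, (ζ.z 0).1 = B.init ∧ AgreeFrom s ζ w ∧ ∀ t j, ¬ Solo A B x t₀ j →
        (x t).proc ≠ some (.b j) → (loc x j t).1 = q → IdleAt ζ t q := by
  classical
  obtain ⟨ζ, l, L, hl, hlL, hL, hinit, hag, hmax, hidle⟩ := h.exists_evac hq hq'
  have hrec : (loc x l t₀).1 ∈ recurrent A B x t₀ := ⟨t₀, le_rfl, l, hl, rfl⟩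
  have hex : ∃ T, L < T ∧ (loc x l T).1 = (loc x l t₀).1 := ⟨t₀, hL, rfl⟩
  obtain ⟨hLT, hT⟩ := Nat.find_spec hex
  have hTt : Nat.find hex ≤ t₀ := Nat.find_min' hex ⟨hL, rfl⟩
  have hmin := fun t => Nat.find_min hex (m := t)
  generalize Nat.find hex = T at *
  -- Without a move at `T - 1` the process would be in the target state already then, against the
  -- choice of `T`, or `T - 1 = L` and the target would be `q`, which is not recurrent.
  have hmv : ζ.mv (T - 1) := by
    by_contra hcon
    rw [(hag (T - 1) (by omega)).2] at hcon
    have hloc := h.loc_succ hcon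
    rw [Nat.sub_add_cancel (by omega)] at hloc
    rcases Nat.lt_or_ge L (T - 1) with h1 | h1
    · exact hmin (T - 1) (by omega) ⟨h1, by rw [← hloc, hT]⟩
    · obtain rfl : L = T - 1 := by omega
      rw [← hloc, hT] at hlL
      exact hq' (hlL ▸ hrec)
  refine ⟨_, hrec, fun w hw => ⟨ζ.splice w T ?_ (Or.inr hmv), Trace.splice_init hinit,
    fun t ht => Trace.splice_of_le (by omega), fun t j hj hp hjq => ?_⟩⟩
  · rw [(hag T hLT.le).1, hw T (by omega), hT]
  · have htL := hmax t ⟨j, hj, hjq⟩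
    have htT : t < T := by omega
    refine ⟨?_, ?_⟩
    · rw [(Trace.splice_of_lt htT).2]
      exact (hidle t j hj hp hjq).1
    · rw [(Trace.splice_of_lt htT).1]
      exact (hidle t j hj hp hjq).2

end Pairs

/-! ### Saving one copy when all states are live -/

section AllLive

variable {QA QB IA IB : Type*} {A : Template QA QB QA IA} {B : Template QA QB QB IB} {n m : ℕ}
  {x : ℕ → Config QA QB IA IB n} {t₀ P : ℕ}

theorem Lasso.exists_relay_flood (h : Lasso A B x t₀ P) {s tw : ℕ} (hs : t₀ + P ≤ s) {r : QB}
    (hr : r ∈ recurrent A B x t₀) {p : Fin n} (hp : ¬ Stuck A B x t₀ (.b p)) {a K c : ℕ}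
    {φ : ℕ → ℕ} {L : ℕ → QB × IB} (C : Clock x P p a K φ L) (hc : c < K) (hsa : s ≤ a)
    (hatw : a ≤ tw) (hL : (L c).1 = r) :
    ∃ ζ : Trace x, (ζ.z 0).1 = B.init ∧ (∀ t < s, Visits A B x t₀ r t → IdleAt ζ t r) ∧
      AgreeFrom s ζ (h.relay C hc) ∧ ζ.z (tw + 6 * P) = ζ.z tw ∧
      (∀ t ≥ tw, ∃ j, ¬ Solo A B x t₀ j ∧ ∃ t' ≥ t₀, (ζ.z t).1 = (loc x j t').1) ∧
      ∃ t, tw ≤ t ∧ t < tw + 6 * P ∧ ζ.mv t := by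
  obtain ⟨ζ, e1, e2, e3⟩ := h.exists_flood (w := h.relay C hc) (h.exists_visits_le hs hr)
    (fun t ht => by rw [h.relay_z_of_le C hc (ht.trans hsa), hL])
    (fun t ht => h.relay_not_mv_of_lt C hc (ht.trans_le hsa))
  exact ⟨ζ, e1, e3, e2, h.relay_core C hc hp (by omega) (hsa.trans hatw) hatw e2⟩

/-- Two traces for each state except for one, if some process keeps moving between two states. -/
theorem Lasso.exists_core_three (h : Lasso A B x t₀ P) (hlive : ∀ r, r ∈ liveStates A B x t₀)
    {p : Fin n} (hp : ¬ Stuck A B x t₀ (.b p)) {t₁ t₂ : ℕ} (ht₁ : t₀ ≤ t₁) (ht₂ : t₀ ≤ t₂)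
    (hne : (loc x p t₁).1 ≠ (loc x p t₂).1) :
    ∃ (r : QB) (ζ : {k : QB × Fin 2 // k ≠ (r, 1)} → Trace x) (s tw : ℕ),
      Core A B x t₀ P ζ s tw (6 * P) ∧ ∀ k, ∃ t, tw ≤ t ∧ t < tw + 6 * P ∧ (ζ k).mv t := by
  have hP := h.pos
  have hrec : ∀ r, r ∈ recurrent A B x t₀ := fun r => liveStates_subset (hlive r)
  set s := t₀ + P with hs
  set tw := s + 2 * P with htw
  have hEa : ∀ r, ∃ p, ¬ Stuck A B x t₀ (.b p) ∧ ∃ a, s ≤ a ∧ a < s + P ∧ (loc x p a).1 = r := by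
    intro r
    obtain ⟨p, hp, t, ht, hr⟩ := hlive r
    exact ⟨p, hp, h.exists_loc_eq ht hr (by omega)⟩
  choose p' hp' a' ha ha' har using hEa
  have hC := fun r => h.clock_two (p' r) (show t₀ ≤ a' r by have := ha r; omega)
  obtain ⟨a, ha1, ha2, ha3⟩ := h.exists_loc_eq ht₁ rfl (show t₀ ≤ s by omega)
  obtain ⟨b, hb1, hb2, hb3⟩ := h.exists_loc_eq ht₂ rfl (show t₀ ≤ a by omega)
  set r₁ := (loc x p t₁).1
  set r₂ := (loc x p t₂).1
  have hab : a ≠ b := by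
    rintro rfl
    exact hne (ha3.symm.trans hb3)
  obtain ⟨δ, rfl⟩ := Nat.exists_eq_add_of_le hb1
  have C3 := h.clock_three p (a := a) (δ := δ) (by omega) (by omega) (by omega)
  have key : ∀ k : {k : QB × Fin 2 // k ≠ (r₂, 1)}, ∃ ζ : Trace x, (ζ.z 0).1 = B.init ∧
      (∀ t < s, Visits A B x t₀ k.1.1 t → IdleAt ζ t k.1.1) ∧
      (ζ.z (tw + 6 * P) = ζ.z tw ∧
      (∀ t ≥ tw, ∃ j, ¬ Solo A B x t₀ j ∧ ∃ t' ≥ t₀, (ζ.z t).1 = (loc x j t').1) ∧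
      ∃ t, tw ≤ t ∧ t < tw + 6 * P ∧ ζ.mv t) ∧
      (k.1.1 ≠ r₁ → k.1.1 ≠ r₂ → AgreeFrom s ζ (h.relay (hC k.1.1) k.1.2.isLt)) ∧
      (k.1 = (r₁, 0) → AgreeFrom s ζ (h.relay C3 (c := 0) (by omega))) ∧
      (k.1 = (r₂, 0) → AgreeFrom s ζ (h.relay C3 (c := 1) (by omega))) ∧
      (k.1 = (r₁, 1) → AgreeFrom s ζ (h.relay C3 (c := 2) (by omega))) := by
    rintro ⟨⟨r, i⟩, hk⟩
    -- The roles 0, 1, 2 of the relay of three start in `r₁`, `r₂`, `r₁` and are given to `(r₁, 0)`,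
    -- `(r₂, 0)`, `(r₁, 1)`. Every other state has a relay of two.
    by_cases h1 : r = r₁
    · subst h1
      fin_cases i
      · obtain ⟨ζ, e1, e2, e3, e4⟩ := h.exists_relay_flood (tw := tw) hs.ge (hrec r₁) hp C3
          (c := 0) (by omega) ha1 (by omega) (by simpa using ha3)
        exact ⟨ζ, e1, e2, e4, by simp, by simp [e3], by simp [hne], by simp⟩
      · obtain ⟨ζ, e1, e2, e3, e4⟩ := h.exists_relay_flood (tw := tw) hs.ge (hrec r₁) hp C3
          (c := 2) (by omega) ha1 (by omega) (by simpa using ha3)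
        exact ⟨ζ, e1, e2, e4, by simp, by simp, by simp, by simp [e3]⟩
    · by_cases h2 : r = r₂
      · subst h2
        obtain rfl : i = 0 := by
          fin_cases i
          · rfl
          · exact absurd rfl hk
        obtain ⟨ζ, e1, e2, e3, e4⟩ := h.exists_relay_flood (tw := tw) hs.ge (hrec r₂) hp C3
          (c := 1) (by omega) ha1 (by omega) (by simpa using hb3)
        exact ⟨ζ, e1, e2, e4, by simp, by simp [hne.symm], by simp [e3], by simp⟩
      · obtain ⟨ζ, e1, e2, e3, e4⟩ := h.exists_relay_flood (tw := tw) hs.ge (hrec r) (hp' r) (hC r)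
          i.isLt (ha r) (by have := ha' r; omega) (har r)
        exact ⟨ζ, e1, e2, e4, fun _ _ => e3, by simp [h1], by simp [h2], by simp [h1]⟩
  choose ζ hinit hearly hcore h2 h30 h31 h32 using key
  refine ⟨r₂, ζ, s, tw, ⟨by omega, by omega, by omega, Dvd.intro_left 6 rfl, hinit, ?_, ?_,
    fun k => (hcore k).1, fun k => (hcore k).2.1, fun k => Or.inl (hcore k).2.2⟩,
    fun k => (hcore k).2.2⟩
  · exact fun r _ => ⟨⟨(r, 0), by simp⟩, hearly ⟨(r, 0), by simp⟩⟩
  · intro r _ t ht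
    have hthree : ∀ f o : ℕ, ∃ c < 3, f % 3 ≠ c ∧ (f + (c + 3 - f % 3) % 3) % 2 = o % 2 := by
      intro f o
      rcases Nat.mod_two_eq_zero_or_one (f + o) with e | e
      · exact ⟨(f + 2) % 3, by omega, by omega, by omega⟩
      · exact ⟨(f + 1) % 3, by omega, by omega, by omega⟩
    by_cases hr : r = r₁ ∨ r = r₂
    · have hidle : ∃ c, ∃ hc : c < 3, IdleAt (h.relay C3 hc) t r := by
        rcases hr with rfl | rfl
        · obtain ⟨c, hc, e1, e2⟩ := hthree _ 0
          obtain ⟨e3, e4⟩ := h.relay_idle C3 hc e1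
          refine ⟨c, hc, e3, ?_⟩
          rw [e4, if_pos e2, ha3]
        · obtain ⟨c, hc, e1, e2⟩ := hthree _ 1
          obtain ⟨e3, e4⟩ := h.relay_idle C3 hc e1
          refine ⟨c, hc, e3, ?_⟩
          rw [e4, if_neg (by omega), hb3]
      obtain ⟨c, hc, hi⟩ := hidle
      obtain rfl | rfl | rfl : c = 0 ∨ c = 1 ∨ c = 2 := by omega
      · exact ⟨⟨(r₁, 0), by simp⟩, (h30 ⟨(r₁, 0), by simp⟩ rfl).idleAt ht hi⟩
      · exact ⟨⟨(r₂, 0), by simp⟩, (h31 ⟨(r₂, 0), by simp⟩ rfl).idleAt ht hi⟩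
      · exact ⟨⟨(r₁, 1), by simp [hne]⟩, (h32 ⟨(r₁, 1), by simp [hne]⟩ rfl).idleAt ht hi⟩
    · push Not at hr
      have hi : ∀ i : Fin 2, (t - a' r) / P % 2 ≠ i →
          ∃ k, IdleAt (ζ k) t r := by
        intro i hi
        refine ⟨⟨(r, i), by simp [hr.2]⟩, (h2 ⟨(r, i), by simp [hr.2]⟩ hr.1 hr.2).idleAt ht ?_⟩
        obtain ⟨e1, e2⟩ := h.relay_idle (hC r) i.isLt hi
        exact ⟨e1, by rw [e2]; exact har r⟩
      by_cases hφ : (t - a' r) / P % 2 = 0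
      · exact hi 1 (by rw [hφ]; decide)
      · exact hi 0 hφ

theorem Path.of_self_loops {c : Situation QA QB IA IB m} (l : List (Proc m))
    (hl : ∀ p ∈ l, Move A B p c c) : Path A B c (l.map fun p => (c, p)) c := by
  induction l with
  | nil => exact .nil c
  | cons p l ih =>
    exact .cons (hl p (by simp)) (ih fun q hq => hl q (by simp [hq]))

theorem hasLocalDeadlock_of_self_loops {c₀ c : Situation QA QB IA IB m}
    {l : List (Situation QA QB IA IB m × Proc m)} (h₀ : c₀.1 = initState A B m)
    (hl : Path A B c₀ l c) (ha : ¬ Enabled A B c.1 c.2 .a)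
    (hb : ∀ i, Move A B (.b i) c c ∨ ¬ Enabled A B c.1 c.2 (.b i))
    (hex : ∃ i, Move A B (.b i) c c) : HasLocalDeadlock A B m := by
  classical
  let L := ((Finset.univ.filter fun i => Move A B (.b i) c c).toList).map Proc.b
  have hL : ∀ i, .b i ∈ L ↔ Move A B (.b i) c c := by simp [L]
  have hL' : ∀ p ∈ L, Move A B p c c := by
    intro p hp
    cases p with
    | a => simp [L] at hp
    | b i => exact (hL i).1 hp
  refine hasLocalDeadlock_of_loop h₀ hl (Path.of_self_loops L hL') ?_ ?_ ⟨.a, ?_⟩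
  · obtain ⟨i, hi⟩ := hex
    exact List.ne_nil_of_mem (List.mem_map.2 ⟨_, (hL i).2 hi, rfl⟩)
  · intro p
    cases p with
    | a =>
      right
      intro k hk
      obtain ⟨q, -, rfl⟩ := List.mem_map.1 hk
      exact ha
    | b i =>
      rcases hb i with hi | hi
      · exact Or.inl ⟨c, List.mem_map.2 ⟨_, (hL i).2 hi, rfl⟩⟩
      · right
        intro k hk
        obtain ⟨q, -, rfl⟩ := List.mem_map.1 hk
        exact hi
  · intro k hk
    obtain ⟨q, -, rfl⟩ := List.mem_map.1 hk
    exact ha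

theorem move_self {c : Situation QA QB IA IB m} {i : Fin m} {g : Set (QA ⊕ QB)}
    (hδ : (c.1.2 i, c.2.2 i, g, c.1.2 i) ∈ B.delta) (hg : Satisfies c.1 (.b i) g) :
    Move A B (.b i) c c :=
  ⟨⟨g, c.1.2 i, hδ, hg, by simp⟩, fun _ _ => rfl⟩

/-- If all states of `B` are live and `A` is stuck, then every assignment of states to the copies
that uses all states is reachable, with arbitrary inputs. -/
theorem Lasso.exists_path_surjective (h : Lasso A B x t₀ P) (hA : Stuck A B x t₀ .a)
    (hlive : ∀ r, r ∈ liveStates A B x t₀) {ρ : Fin m → QB} (hρ : Function.Surjective ρ)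
    (τ : Fin m → IB) :
    ∃ c₀ l, c₀.1 = initState A B m ∧
      Path A B c₀ l (((x t₀).state.1, ρ), ((x t₀).input.1, τ)) := by
  have hflood : ∀ i, ∃ ζ : Trace x, (ζ.z 0).1 = B.init ∧
      AgreeFrom (t₀ + P) ζ (Trace.const x (ρ i, τ i)) ∧
      ∀ t < t₀ + P, Visits A B x t₀ (ρ i) t → IdleAt ζ t (ρ i) := fun i =>
    h.exists_flood (h.exists_visits_le le_rfl (liveStates_subset (hlive _)))
      (fun _ _ => rfl) fun _ _ => id
  choose ζ hinit hag hearly using hflood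
  have hns : ∀ j, ¬ Solo A B x t₀ j := by
    intro j hj
    obtain ⟨p, hp, t, ht, hr⟩ := hlive (loc x j t₀).1
    exact hj.2 p (fun e => hp (e ▸ hj.1)) t ht hr
  obtain ⟨l, hl⟩ := h.exists_path_zero ζ (by
    intro t j _
    obtain ⟨i, hi⟩ := hρ (loc x j t).1
    rcases lt_or_ge t (t₀ + P) with ht | ht
    · obtain ⟨h1, h2⟩ := hearly i t ht ⟨j, hns j, hi.symm⟩
      exact ⟨i, h1, by rw [h2, hi]⟩
    · refine ⟨i, ?_, ?_⟩
      · rw [(hag i t ht).2]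
        exact id
      · rw [(hag i t ht).1, ← hi]
        rfl) (t₀ + P)
  refine ⟨_, l, h.copies_init hinit, ?_⟩
  obtain ⟨e1, e2⟩ := h.a_eq_of_disabled hA (Nat.le_add_right t₀ P)
  have hz : ∀ i, (ζ i).z (t₀ + P) = (ρ i, τ i) := fun i => (hag i _ le_rfl).1
  simpa only [copies, e1, e2, hz] using hl

/-- Fairness makes a live process in state `r` move after `t₀`, and as it never changes its state,
this transition is a self-loop. -/
theorem Lasso.exists_self_loop (h : Lasso A B x t₀ P) (hA : Stuck A B x t₀ .a)
    (hlive : ∀ r, r ∈ liveStates A B x t₀)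
    (hstatic : ∀ p, ∀ t ≥ t₀, (loc x p t).1 = (loc x p t₀).1) (r : QB) :
    ∃ σ g, (r, σ, g, r) ∈ B.delta ∧ (Sum.inl (x t₀).state.1 ∈ g ∨ ∃ u, Sum.inr u ∈ g) := by
  obtain ⟨p, hp, t, ht, hr⟩ := hlive r
  obtain ⟨s, hs, hps⟩ := (h.fair (.b p)).resolve_left hp
  obtain ⟨g, q', hδ, ⟨p', hp', hg⟩, he⟩ := h.step_of_proc hps
  have h1 : (x s).state.2 p = r := by rw [← hr, hstatic p t ht, ← hstatic p s hs]; rfl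
  have h2 : q' = r := by
    have : (loc x p (s + 1)).1 = q' := by simp [loc, he]
    rw [← this, hstatic p (s + 1) (by omega), ← hstatic p s hs]
    exact h1
  rw [h1, h2] at hδ
  refine ⟨_, g, hδ, ?_⟩
  cases p' with
  | a =>
    left
    rw [component, (h.a_eq_of_disabled hA hs).1] at hg
    exact hg
  | b j => exact Or.inr ⟨_, hg⟩

theorem card_ne_pair [Fintype QB] (r : QB) :
    Nat.card {k : QB × Fin 2 // k ≠ (r, 1)} = 2 * Fintype.card QB - 1 := by
  classical
  rw [Nat.card_eq_fintype_card, Fintype.card_subtype_compl, Fintype.card_prod, Fintype.card_fin,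
    mul_comm]
  simp

/-- The case where `A` is stuck and the copies of `B` keep looping in their states. -/
theorem Lasso.deadlock_of_static [Fintype QB] (h : Lasso A B x t₀ P) (hA : Stuck A B x t₀ .a)
    (hlive : ∀ r, r ∈ liveStates A B x t₀)
    (hstatic : ∀ p, ∀ t ≥ t₀, (loc x p t).1 = (loc x p t₀).1) :
    HasDeadlock A B (2 * Fintype.card QB - 1) ∧
      (2 ≤ Fintype.card QB → HasLocalDeadlock A B (2 * Fintype.card QB - 1)) := by
  classical
  choose σ g hδ hg using h.exists_self_loop hA hlive hstatic
  have hdeadA : ∀ (m : ℕ) (ρ : Fin m → QB) (τ : Fin m → IB),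
      ¬ Enabled A B ((x t₀).state.1, ρ) ((x t₀).input.1, τ) .a := by
    intro m ρ τ
    refine h.not_enabled_a (c := (((x t₀).state.1, ρ), ((x t₀).input.1, τ))) hA rfl rfl fun i => ?_
    obtain ⟨p, -, t, ht, hr⟩ := hlive (ρ i)
    exact ⟨p, t, ht, hr.symm⟩
  have hpairs : ∀ r₀, ∃ (ρ : Fin (2 * Fintype.card QB - 1) → QB) (k₀ : Fin _),
      Function.Surjective ρ ∧ ρ k₀ = r₀ ∧ ∀ i ≠ k₀, ∃ i' ≠ i, i' ≠ k₀ ∧ ρ i' = ρ i := by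
    intro r₀
    let e : {k : QB × Fin 2 // k ≠ (r₀, 1)} ≃ Fin (2 * Fintype.card QB - 1) :=
      Finite.equivFinOfCardEq (card_ne_pair r₀)
    refine ⟨fun i => (e.symm i).1.1, e ⟨(r₀, 0), by simp⟩, fun r => ⟨e ⟨(r, 0), by simp⟩, by simp⟩,
      by simp, ?_⟩
    intro i hi
    obtain ⟨⟨⟨r, b⟩, hk⟩, rfl⟩ := e.surjective i
    have hr : r ≠ r₀ := by
      rintro rfl
      fin_cases b
      · exact hi rfl
      · exact hk rfl
    exact ⟨e ⟨(r, 1 - b), by simp [hr]⟩, by fin_cases b <;> simp, by simp [hr], by simp⟩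
  have hloop : ∀ {m : ℕ} {ρ : Fin m → QB} {i : Fin m}, (Sum.inl (x t₀).state.1 ∈ g (ρ i) ∨
      ∃ i' ≠ i, Sum.inr (ρ i') ∈ g (ρ i)) →
      Move A B (.b i) (((x t₀).state.1, ρ), ((x t₀).input.1, σ ∘ ρ))
        (((x t₀).state.1, ρ), ((x t₀).input.1, σ ∘ ρ)) := by
    rintro m ρ i hi
    refine move_self (hδ (ρ i)) ?_
    rcases hi with hi | ⟨i', hne, hi⟩
    · exact ⟨.a, by simp, hi⟩
    · exact ⟨.b i', fun e => hne (by cases e; rfl), hi⟩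
  -- Only the state `r₀` has a single copy. This copy can loop if the guard of its loop is satisfied
  -- by `A` or by a state other than `r₀`; in all other states the partner is seen as well.
  by_cases hcase : ∃ r₀, Sum.inl (x t₀).state.1 ∈ g r₀ ∨ ∃ u ≠ r₀, Sum.inr u ∈ g r₀
  · obtain ⟨r₀, hr₀⟩ := hcase
    obtain ⟨ρ, k₀, hsurj, hk₀, hpair⟩ := hpairs r₀
    obtain ⟨c₀, l, h0, hl⟩ := h.exists_path_surjective hA hlive hsurj (σ ∘ ρ)
    have hmove : ∀ i, Move A B (.b i) (((x t₀).state.1, ρ), ((x t₀).input.1, σ ∘ ρ))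
        (((x t₀).state.1, ρ), ((x t₀).input.1, σ ∘ ρ)) := by
      intro i
      apply hloop
      by_cases hi : i = k₀
      · subst hi
        rw [hk₀]
        refine hr₀.imp_right ?_
        rintro ⟨u, hu, hgu⟩
        obtain ⟨i', rfl⟩ := hsurj u
        exact ⟨i', fun e => hu (by rw [e, hk₀]), hgu⟩
      · refine (hg (ρ i)).imp_right ?_
        rintro ⟨u, hgu⟩
        by_cases hu : u = ρ i
        · obtain ⟨i', h1, -, h2⟩ := hpair i hi
          exact ⟨i', h1, by rw [h2, ← hu]; rwa [← hu] at hgu⟩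
        · obtain ⟨i', rfl⟩ := hsurj u
          exact ⟨i', fun e => hu (by rw [e]), hgu⟩
    have hlocal := hasLocalDeadlock_of_self_loops h0 hl (hdeadA _ _ _)
      (fun i => Or.inl (hmove i)) ⟨k₀, hmove k₀⟩
    exact ⟨Or.inl hlocal, fun _ => hlocal⟩
  · push Not at hcase
    have hself : ∀ r, Sum.inr r ∈ g r := by
      intro r
      rcases hg r with h1 | ⟨u, hu⟩
      · exact absurd h1 (hcase r).1
      · by_cases hur : u = r
        · rwa [hur] at hu
        · exact absurd hu ((hcase r).2 u hur)
    -- The state with a single copy is now arbitrary; `B.init` is just some state.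
    obtain ⟨ρ, k₀, hsurj, hk₀, hpair⟩ := hpairs B.init
    obtain ⟨c₀, l, h0, hl⟩ := h.exists_path_surjective hA hlive hsurj (σ ∘ ρ)
    have hmove : ∀ i ≠ k₀, Move A B (.b i) (((x t₀).state.1, ρ), ((x t₀).input.1, σ ∘ ρ))
        (((x t₀).state.1, ρ), ((x t₀).input.1, σ ∘ ρ)) := by
      intro i hi
      obtain ⟨i', h1, -, h2⟩ := hpair i hi
      exact hloop (Or.inr ⟨i', h1, h2 ▸ hself _⟩)
    -- The single copy may see no state in the guard of its loop. If it is enabled, it loops by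
    -- another transition or jumps to a state where it finds partners, and then all copies loop. If
    -- it is disabled, it stays so while the others loop.
    by_cases hen : Enabled A B ((x t₀).state.1, ρ) ((x t₀).input.1, σ ∘ ρ) (.b k₀)
    · obtain ⟨s', g', q', hδ', hg', rfl⟩ := hen
      have hcomp : σ ∘ Function.update ρ k₀ q' = Function.update (σ ∘ ρ) k₀ (σ q') := by
        rw [Function.comp_update]
      have hjump : Move A B (.b k₀) (((x t₀).state.1, ρ), ((x t₀).input.1, σ ∘ ρ))
          (((x t₀).state.1, Function.update ρ k₀ q'),
            ((x t₀).input.1, σ ∘ Function.update ρ k₀ q')) := by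
        refine ⟨⟨g', q', hδ', hg', rfl⟩, fun p hp => ?_⟩
        cases p with
        | a => rfl
        | b i =>
          have hi : i ≠ k₀ := fun e => hp (by rw [e])
          simp [component, hi]
      have hlocal : HasLocalDeadlock A B (2 * Fintype.card QB - 1) := by
        by_cases hq : q' = ρ k₀
        · subst hq
          rw [Function.update_eq_self] at hjump
          refine hasLocalDeadlock_of_self_loops h0 hl (hdeadA _ _ _) (fun i => ?_) ⟨k₀, hjump⟩
          by_cases hi : i = k₀
          · exact Or.inl (hi ▸ hjump)
          · exact Or.inl (hmove i hi)
        · have hmove' : ∀ i, Move A B (.b i) (((x t₀).state.1, Function.update ρ k₀ q'),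
              ((x t₀).input.1, σ ∘ Function.update ρ k₀ q'))
              (((x t₀).state.1, Function.update ρ k₀ q'),
              ((x t₀).input.1, σ ∘ Function.update ρ k₀ q')) := by
            intro i
            apply hloop
            right
            by_cases hi : i = k₀
            · subst hi
              obtain ⟨i', rfl⟩ := hsurj q'
              have hne : i' ≠ i := fun e => hq (by rw [e])
              exact ⟨i', hne, by simpa [hne] using hself _⟩
            · obtain ⟨i', h1, h2, h3⟩ := hpair i hi
              exact ⟨i', h1, by simpa [hi, h2, h3] using hself _⟩
          exact hasLocalDeadlock_of_self_loops h0 (hl.append (.single hjump)) (hdeadA _ _ _)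
            (fun i => Or.inl (hmove' i)) ⟨k₀, hmove' k₀⟩
      exact ⟨Or.inl hlocal, fun _ => hlocal⟩
    · have hlocal : (∃ i, i ≠ k₀) → HasLocalDeadlock A B (2 * Fintype.card QB - 1) := by
        rintro ⟨i, hi⟩
        refine hasLocalDeadlock_of_self_loops h0 hl (hdeadA _ _ _) (fun i => ?_) ⟨i, hmove i hi⟩
        by_cases hi : i = k₀
        · exact Or.inr (hi ▸ hen)
        · exact Or.inl (hmove i hi)
      refine ⟨?_, fun hcard => hlocal ?_⟩
      · by_cases hex : ∃ i, i ≠ k₀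
        · exact Or.inl (hlocal hex)
        -- There is no other copy, so nothing at all is enabled: the deadlock is global.
        · push Not at hex
          refine Or.inr (hasGlobalDeadlock_of_path h0 hl fun p => ?_)
          cases p with
          | a => exact hdeadA _ _ _
          | b i => exact hex i ▸ hen
      · have : Nontrivial (Fin (2 * Fintype.card QB - 1)) := Fin.nontrivial_iff_two_le.2 (by omega)
        exact exists_ne k₀

end AllLive

/-! ### Counting copies and conclusion -/

section Bounding

variable {QA QB IA IB : Type*} {A : Template QA QB QA IA} {B : Template QA QB QB IB} {n m : ℕ}
  {x : ℕ → Config QA QB IA IB n} {t₀ P : ℕ}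

/-- If nothing moves in the loop, then `A` is stuck and all traces are dead, and the deadlock is
global instead of local. -/
theorem Cover.hasDeadlock {κ : Type*} [Finite κ] [Nonempty κ] {ζ : κ → Trace x} {tw Q : ℕ}
    (C : Cover A B x t₀ P ζ tw Q) (h : Lasso A B x t₀ P)
    (hm : Nat.card {d // Solo A B x t₀ d} + Nat.card κ ≤ m)
    (hdead : Stuck A B x t₀ .a ∨ (∃ d, Solo A B x t₀ d) ∨
      ∃ k, DeadTrace A B x t₀ tw (ζ k)) : HasDeadlock A B m := by
  obtain ⟨h1, h2⟩ := C.deadlock h hm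
  by_cases hmove : (∃ t ≥ t₀, (x t).proc = some .a) ∨ ∃ k t, tw ≤ t ∧ t < tw + Q ∧ (ζ k).mv t
  · exact Or.inl (h1 hmove hdead)
  · rw [not_or] at hmove
    exact Or.inr (h2 ((h.fair .a).resolve_right hmove.1)
      fun k => (C.live_or_dead k).resolve_left fun hk => hmove.2 ⟨k, hk⟩)

theorem Cover.hasGlobalDeadlock {κ : Type*} [Finite κ] [Nonempty κ] {ζ : κ → Trace x} {tw Q : ℕ}
    (C : Cover A B x t₀ P ζ tw Q) (h : Lasso A B x t₀ P)
    (hm : Nat.card {d // Solo A B x t₀ d} + Nat.card κ ≤ m)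
    (hstuck : ∀ p, Stuck A B x t₀ p) : HasGlobalDeadlock A B m := by
  refine (C.deadlock h hm).2 (hstuck .a) fun k => (C.live_or_dead k).resolve_left ?_
  rintro ⟨t, ht, -, hmv⟩
  obtain ⟨j, hj, -⟩ := (ζ k).move t hmv
  exact h.proc_ne_of_disabled (hstuck (.b j)) (C.le.trans ht) hj

theorem exists_dead_of_stuck (hD : ∃ p, Stuck A B x t₀ p) :
    Stuck A B x t₀ .a ∨ (∃ d, Solo A B x t₀ d) ∨ (deadStates A B x t₀).Nonempty := by
  obtain ⟨p, hp⟩ := hD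
  cases p with
  | a => exact Or.inl hp
  | b d =>
    by_cases hd : Solo A B x t₀ d
    · exact Or.inr (Or.inl ⟨d, hd⟩)
    · exact Or.inr (Or.inr ⟨_, d, hp, hd, rfl⟩)

theorem exists_live_of_move (h : Lasso A B x t₀ P) (hM : ∃ p, ∃ t ≥ t₀, (x t).proc = some p) :
    (∃ t ≥ t₀, (x t).proc = some .a) ∨ (liveStates A B x t₀).Nonempty := by
  obtain ⟨p, t, ht, hp⟩ := hM
  cases p with
  | a => exact Or.inl ⟨t, ht, hp⟩
  | b j => exact Or.inr ⟨_, j, fun hs => h.proc_ne_of_disabled hs ht hp, t, ht, rfl⟩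

/-- Solo processes sit in distinct states, and none of these is recurrent. -/
theorem card_solo_add_recurrent_le [Fintype QB] (A : Template QA QB QA IA)
    (B : Template QA QB QB IB) (x : ℕ → Config QA QB IA IB n) (t₀ : ℕ) :
    Nat.card {d // Solo A B x t₀ d} + (recurrent A B x t₀).ncard ≤ Fintype.card QB := by
  have h1 : Nat.card {d // Solo A B x t₀ d} =
      (Set.range fun d : {d // Solo A B x t₀ d} => (loc x d t₀).1).ncard := by
    rw [← Nat.card_coe_set_eq, Nat.card_range_of_injective solo_injective]
  have hdisj : Disjoint (Set.range fun d : {d // Solo A B x t₀ d} => (loc x d t₀).1)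
      (recurrent A B x t₀) := by
    rw [Set.disjoint_left]
    rintro _ ⟨d, rfl⟩ ⟨t, ht, j, hj, hr⟩
    exact d.2.2 j (fun e => hj (e ▸ d.2)) t ht hr
  rw [h1, ← Set.ncard_union_eq hdisj, ← Nat.card_eq_fintype_card]
  exact Set.ncard_le_card _

theorem Lasso.deadlock_of_card [Fintype QB] (h : Lasso A B x t₀ P)
    (hR : (recurrent A B x t₀).Nonempty) {E : Set QB} (hE : E ⊆ liveStates A B x t₀)
    (hE' : recurrent A B x t₀ ⊆ deadStates A B x t₀ ∪ E)
    (hm : Nat.card {d // Solo A B x t₀ d} + (visited A B x t₀).ncard + E.ncard ≤ m)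
    (hD : ∃ p, Stuck A B x t₀ p) :
    HasDeadlock A B m ∧
      ((∃ t ≥ t₀, (x t).proc = some .a) ∨ E.Nonempty → HasLocalDeadlock A B m) ∧
      ((∀ p, Stuck A B x t₀ p) → HasGlobalDeadlock A B m) := by
  obtain ⟨ζ, hcore, -, hlive, hdead⟩ := h.exists_core_pairs (s := t₀ + P) le_rfl hE hE'
    (fun _ _ => True) fun r w hw hw' => by
      obtain ⟨ζ, e1, e2, -⟩ := h.exists_flood
        (h.exists_visits_le le_rfl (liveStates_subset (hE r.2))) hw hw'
      exact ⟨ζ, e1, e2, trivial⟩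
  obtain ⟨ξ, C, hξ⟩ := hcore.exists_cover h (visited A B x t₀ \ recurrent A B x t₀) subset_rfl
    fun r h1 h2 h3 => absurd ⟨h1, h2⟩ h3
  obtain ⟨r₀, hr₀⟩ := hR
  have : Nonempty ((recurrent A B x t₀ ⊕ E) ⊕ (visited A B x t₀ \ recurrent A B x t₀ : Set QB)) :=
    ⟨.inl (.inl ⟨r₀, hr₀⟩)⟩
  have hcard := Set.ncard_sdiff_add_ncard_of_subset
    (recurrent_subset_visited (A := A) (B := B) (x := x) (t₀ := t₀))
  have hm' : Nat.card {d // Solo A B x t₀ d} + Nat.card ((recurrent A B x t₀ ⊕ E) ⊕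
      (visited A B x t₀ \ recurrent A B x t₀ : Set QB)) ≤ m := by
    rw [Nat.card_sum, Nat.card_sum, Nat.card_coe_set_eq, Nat.card_coe_set_eq, Nat.card_coe_set_eq]
    omega
  have hdead' : Stuck A B x t₀ .a ∨ (∃ d, Solo A B x t₀ d) ∨
      ∃ k, DeadTrace A B x t₀ (t₀ + P + P) (ξ k) :=
    (exists_dead_of_stuck hD).imp_right (Or.imp_right fun ⟨r, hr⟩ =>
      ⟨.inl (.inl ⟨r, deadStates_subset hr⟩), by rw [hξ]; exact hdead _ hr⟩)
  refine ⟨C.hasDeadlock h hm' hdead', fun hmove => ?_, C.hasGlobalDeadlock h hm'⟩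
  refine (C.deadlock h hm').1 (hmove.imp_right ?_) hdead'
  rintro ⟨r, hr⟩
  obtain ⟨t, ht⟩ := hlive ⟨r, hr⟩
  exact ⟨.inl (.inr ⟨r, hr⟩), t, by rwa [hξ]⟩

/-- The copy for `q` is saved, whence the `m + 1`: before time `s` the second copy of a pair has no
duties, so it floods `q`, follows the last process that leaves `q` into a recurrent state `r₀`, and
waits there for its turn. -/
theorem Lasso.hasLocalDeadlock_of_evac [Fintype QB] (h : Lasso A B x t₀ P)
    (hlive : recurrent A B x t₀ ⊆ liveStates A B x t₀) {q : QB} (hq : q ∈ visited A B x t₀)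
    (hq' : q ∉ recurrent A B x t₀)
    (hm : Nat.card {d // Solo A B x t₀ d} + (visited A B x t₀).ncard +
      (recurrent A B x t₀).ncard ≤ m + 1)
    (hD : ∃ p, Stuck A B x t₀ p) : HasLocalDeadlock A B m := by
  obtain ⟨r₀, hr₀, hevac⟩ := h.exists_evac_into hq hq' (s := t₀ + P) (Nat.le_add_right _ _)
  obtain ⟨ζ, hcore, hX, hmove, hdead⟩ := h.exists_core_pairs (s := t₀ + P) le_rfl hlive
    Set.subset_union_right
    (fun r ζ => (r : QB) = r₀ → ∀ t j, ¬ Solo A B x t₀ j → (x t).proc ≠ some (.b j) →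
      (loc x j t).1 = q → IdleAt ζ t q) fun r w hw hw' => by
      by_cases hr : (r : QB) = r₀
      · obtain ⟨ζ, e1, e2, e3⟩ := hevac w (by rwa [← hr])
        exact ⟨ζ, e1, e2, fun _ => e3⟩
      · obtain ⟨ζ, e1, e2, -⟩ := h.exists_flood (h.exists_visits_le le_rfl r.2) hw hw'
        exact ⟨ζ, e1, e2, fun e => absurd e hr⟩
  set F := (visited A B x t₀ \ recurrent A B x t₀) \ {q} with hF
  obtain ⟨ξ, C, hξ⟩ := hcore.exists_cover h F Set.sdiff_subset fun r h1 h2 h3 => by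
    obtain rfl : r = q := by
      by_contra hne
      exact h3 ⟨⟨h1, h2⟩, hne⟩
    exact ⟨.inr ⟨r₀, hr₀⟩, hX ⟨r₀, hr₀⟩ rfl⟩
  have : Nonempty ((recurrent A B x t₀ ⊕ recurrent A B x t₀) ⊕ F) := ⟨.inl (.inl ⟨r₀, hr₀⟩)⟩
  have hcard := Set.ncard_sdiff_add_ncard_of_subset
    (recurrent_subset_visited (A := A) (B := B) (x := x) (t₀ := t₀))
  have hcard' : F.ncard + 1 = _ := Set.ncard_sdiff_singleton_add_one
    (show q ∈ visited A B x t₀ \ recurrent A B x t₀ from ⟨hq, hq'⟩)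
  refine (C.deadlock h (m := m) ?_).1 (Or.inr ?_) ((exists_dead_of_stuck hD).imp_right
    (Or.imp_right fun ⟨r, hr⟩ =>
      ⟨.inl (.inl ⟨r, deadStates_subset hr⟩), by rw [hξ]; exact hdead _ hr⟩))
  · rw [Nat.card_sum, Nat.card_sum, Nat.card_coe_set_eq, Nat.card_coe_set_eq]
    omega
  · obtain ⟨t, ht⟩ := hmove ⟨r₀, hr₀⟩
    exact ⟨.inl (.inr ⟨r₀, hr₀⟩), t, by rwa [hξ]⟩

/-- The case where all states of `B` are visited again and again by processes that keep moving. -/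
theorem Lasso.deadlock_of_all_live [Fintype QB] (h : Lasso A B x t₀ P) (hA : Stuck A B x t₀ .a)
    (hlive : ∀ r, r ∈ liveStates A B x t₀) :
    HasDeadlock A B (2 * Fintype.card QB - 1) ∧
      (2 ≤ Fintype.card QB → HasLocalDeadlock A B (2 * Fintype.card QB - 1)) := by
  classical
  by_cases hstatic : ∀ p, ∀ t ≥ t₀, (loc x p t).1 = (loc x p t₀).1
  · exact h.deadlock_of_static hA hlive hstatic
  · push Not at hstatic
    obtain ⟨p, t, ht, hne⟩ := hstatic
    have hp : ¬ Stuck A B x t₀ (.b p) := fun hp => hne (by rw [h.loc_eq_of_disabled hp ht])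
    obtain ⟨r, ζ, s, tw, hcore, hmove⟩ := h.exists_core_three hlive hp ht le_rfl hne
    obtain ⟨ξ, C, hξ⟩ := hcore.exists_cover h ∅ (Set.empty_subset _)
      fun r _ h2 _ => absurd (liveStates_subset (hlive r)) h2
    have : Nonempty ({k : QB × Fin 2 // k ≠ (r, 1)} ⊕ (∅ : Set QB)) :=
      ⟨.inl ⟨(r, 0), by simp⟩⟩
    have hlocal : HasLocalDeadlock A B (2 * Fintype.card QB - 1) := by
      refine (C.deadlock h ?_).1 (Or.inr ?_) (Or.inl hA)
      · have huniv : recurrent A B x t₀ = Set.univ :=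
          Set.eq_univ_of_forall fun r => liveStates_subset (hlive r)
        have hsolo := card_solo_add_recurrent_le A B x t₀
        rw [huniv, Set.ncard_univ, Nat.card_eq_fintype_card (α := QB)] at hsolo
        rw [Nat.card_sum, Nat.card_coe_set_eq, Set.ncard_empty, card_ne_pair]
        omega
      · obtain ⟨t, ht⟩ := hmove ⟨(r, 0), by simp⟩
        exact ⟨.inl ⟨(r, 0), by simp⟩, t, by rwa [hξ]⟩
    exact ⟨Or.inl hlocal, fun _ => hlocal⟩

theorem Lasso.bounding [Fintype QB] (h : Lasso A B x t₀ P) (hn : 2 * Fintype.card QB - 1 < n)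
    (hD : ∃ p, Stuck A B x t₀ p) :
    HasDeadlock A B (2 * Fintype.card QB - 1) ∧
      (2 ≤ Fintype.card QB → (∃ p, ∃ t ≥ t₀, (x t).proc = some p) →
        HasLocalDeadlock A B (2 * Fintype.card QB - 1)) ∧
      ((∀ p, Stuck A B x t₀ p) → HasGlobalDeadlock A B (2 * Fintype.card QB - 1)) := by
  have hpos : 0 < Fintype.card QB := Fintype.card_pos_iff.2 ⟨B.init⟩
  obtain ⟨j, hj⟩ := exists_not_solo A B x t₀ (show Fintype.card QB < n by omega)
  have hR : (recurrent A B x t₀).Nonempty := ⟨_, t₀, le_rfl, j, hj, rfl⟩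
  have hRpos := (Set.ncard_pos).2 hR
  have hSR := card_solo_add_recurrent_le A B x t₀
  have hV : (visited A B x t₀).ncard ≤ Fintype.card QB := by
    rw [← Nat.card_eq_fintype_card]; exact Set.ncard_le_card _
  have hempty : recurrent A B x t₀ ⊆ deadStates A B x t₀ →
      HasDeadlock A B (2 * Fintype.card QB - 1) ∧
        ((∀ p, Stuck A B x t₀ p) → HasGlobalDeadlock A B (2 * Fintype.card QB - 1)) := by
    intro hdead
    obtain ⟨h1, -, h3⟩ := h.deadlock_of_card (E := ∅) (m := 2 * Fintype.card QB - 1) hR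
      (Set.empty_subset _) (by simpa using hdead) (by rw [Set.ncard_empty]; omega) hD
    exact ⟨h1, h3⟩
  have hglobal : (∀ p, Stuck A B x t₀ p) → HasGlobalDeadlock A B (2 * Fintype.card QB - 1) :=
    fun hall => (hempty fun r hr => (h.recurrent_subset hr).resolve_right
      fun ⟨p, hp, _⟩ => hp (hall _)).2 hall
  -- A second copy is needed in the recurrent states without a non-solo stuck process. If there are
  -- none, all copies of the cover might be frozen; one live state, if any exists, is then added so
  -- that the simulation keeps moving.
  obtain ⟨E, hE, hE', hne, hform⟩ : ∃ E ⊆ liveStates A B x t₀,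
      recurrent A B x t₀ ⊆ deadStates A B x t₀ ∪ E ∧
      ((liveStates A B x t₀).Nonempty → E.Nonempty) ∧
      (E ∩ deadStates A B x t₀ = ∅ ∨
        recurrent A B x t₀ ⊆ deadStates A B x t₀ ∧ E.ncard ≤ 1) := by
    by_cases hW : recurrent A B x t₀ ⊆ deadStates A B x t₀
    · rcases (liveStates A B x t₀).eq_empty_or_nonempty with he | ⟨r, hr⟩
      · exact ⟨∅, Set.empty_subset _, by simpa using hW, fun h' => by simp [he] at h',
          Or.inl (by simp)⟩
      · exact ⟨{r}, by simpa using hr, hW.trans Set.subset_union_left, fun _ => ⟨r, rfl⟩,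
          Or.inr ⟨hW, by simp⟩⟩
    · obtain ⟨r, hr, hrd⟩ := Set.not_subset.1 hW
      refine ⟨recurrent A B x t₀ \ deadStates A B x t₀, fun q hq =>
        (h.recurrent_subset hq.1).resolve_left hq.2, by simp, fun _ => ⟨r, hr, hrd⟩,
        Or.inl (by simp)⟩
  have hER : E ⊆ recurrent A B x t₀ := hE.trans liveStates_subset
  have hERc := Set.ncard_le_ncard hER
  suffices hmain : HasDeadlock A B (2 * Fintype.card QB - 1) ∧ (2 ≤ Fintype.card QB →
      (∃ p, ∃ t ≥ t₀, (x t).proc = some p) → HasLocalDeadlock A B (2 * Fintype.card QB - 1)) from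
    ⟨hmain.1, hmain.2, hglobal⟩
  rcases Nat.lt_or_ge (2 * Fintype.card QB - 1)
    (Nat.card {d // Solo A B x t₀ d} + (visited A B x t₀).ncard + E.ncard) with hlt | hle
  -- One copy too many means equality in `hSR`, `hV` and `hERc`.
  · obtain rfl : E = recurrent A B x t₀ := Set.eq_of_subset_of_ncard_le hER (by omega)
    have hVuniv : visited A B x t₀ = Set.univ := Set.eq_of_subset_of_ncard_le
      (Set.subset_univ _) (by rw [Set.ncard_univ, Nat.card_eq_fintype_card]; omega)
    by_cases hRuniv : recurrent A B x t₀ = Set.univ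
    · rcases hform with hdead | ⟨hdead, hone⟩
      · rw [Set.inter_eq_self_of_subset_right deadStates_subset] at hdead
        -- Every state is recurrent and none is dead, which excludes solo and other stuck copies of
        -- `B`; so the stuck process is `A`.
        have hA : Stuck A B x t₀ .a := by
          rcases exists_dead_of_stuck hD with hA | ⟨d, hd⟩ | hne
          · exact hA
          · obtain ⟨t, ht, i, hi, hr⟩ : (loc x d t₀).1 ∈ recurrent A B x t₀ :=
              hRuniv ▸ Set.mem_univ _
            exact absurd hr (hd.2 i (fun e => hi (e ▸ hd)) t ht)
          · simp [hdead] at hne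
        obtain ⟨h1, h2⟩ := h.deadlock_of_all_live hA fun r => hE (hRuniv ▸ Set.mem_univ r)
        exact ⟨h1, fun hc _ => h2 hc⟩
      -- Here `|B| ≤ 1`, so that no local deadlock is claimed.
      · rw [hRuniv, Set.ncard_univ, Nat.card_eq_fintype_card] at hone
        exact ⟨(hempty hdead).1, fun hc => absurd hc (by omega)⟩
    · obtain ⟨q, hq⟩ := (Set.ne_univ_iff_exists_notMem _).1 hRuniv
      have hlocal := h.hasLocalDeadlock_of_evac (m := 2 * Fintype.card QB - 1) hE
        (hVuniv ▸ Set.mem_univ q) hq (by omega) hD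
      exact ⟨Or.inl hlocal, fun _ _ => hlocal⟩
  · obtain ⟨h1, h2, -⟩ := h.deadlock_of_card hR hE hE' hle hD
    exact ⟨h1, fun _ hM => h2 ((exists_live_of_move h hM).imp_right hne)⟩

theorem HasLocalDeadlock.bounding [Finite QA] [Fintype QB] [Finite IA] [Finite IB]
    (h : HasLocalDeadlock A B n) (hn : 2 * Fintype.card QB - 1 < n) :
    HasDeadlock A B (2 * Fintype.card QB - 1) ∧
      (2 ≤ Fintype.card QB → HasLocalDeadlock A B (2 * Fintype.card QB - 1)) := by
  obtain ⟨x, t₀, P, hx, hD, hM⟩ := h.exists_lasso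
  obtain ⟨h1, h2, -⟩ := hx.bounding hn hD
  exact ⟨h1, fun hc => h2 hc hM⟩

theorem HasGlobalDeadlock.bounding [Fintype QB] (h : HasGlobalDeadlock A B n)
    (hn : 2 * Fintype.card QB - 1 < n) : HasGlobalDeadlock A B (2 * Fintype.card QB - 1) := by
  obtain ⟨x, t₀, P, hx, hD⟩ := h.exists_lasso
  exact (hx.bounding hn ⟨.a, hD .a⟩).2.2 hD

theorem HasDeadlock.bounding [Finite QA] [Fintype QB] [Finite IA] [Finite IB]
    (h : HasDeadlock A B n) (hn : 2 * Fintype.card QB - 1 < n) :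
    HasDeadlock A B (2 * Fintype.card QB - 1) :=
  h.elim (fun h => (h.bounding hn).1) fun h => Or.inr (h.bounding hn)

theorem HasDeadlock.succ [Finite QA] [Fintype QB] [Finite IA] [Finite IB]
    (h : HasDeadlock A B n) (hn : Fintype.card QB < n) : HasDeadlock A B (n + 1) :=
  h.imp (fun h => h.succ hn) fun h => h.succ hn

theorem isCutoff_of_succ {D : ℕ → Prop} {c : ℕ} (hb : ∀ n > c, D n → D c)
    (hm : ∀ n ≥ c, D n → D (n + 1)) : IsCutoff D c := by
  intro n hn
  refine ⟨fun h => ?_, fun h => ?_⟩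
  · rcases hn.lt_or_eq with h' | h'
    · exact hb n h' h
    · rwa [h']
  · induction n, hn using Nat.le_induction with
    | base => exact h
    | succ n hn ih => exact hm n hn ih

end Bounding

end GuardedProtocol

theorem mainTheorem3 {QA QB IA IB : Type*} [Finite QA] [Fintype QB] [Finite IA] [Finite IB]
    (A : GuardedProtocol.Template QA QB QA IA) (B : GuardedProtocol.Template QA QB QB IB) :
    -- Bounding
    (2 ≤ Fintype.card QB → ∀ n > 2 * Fintype.card QB - 1,
      GuardedProtocol.HasLocalDeadlock A B n →
        GuardedProtocol.HasLocalDeadlock A B (2 * Fintype.card QB - 1)) ∧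
    (∀ n > 2 * Fintype.card QB - 1, GuardedProtocol.HasGlobalDeadlock A B n →
      GuardedProtocol.HasGlobalDeadlock A B (2 * Fintype.card QB - 1)) ∧
    (∀ n > 2 * Fintype.card QB - 1, GuardedProtocol.HasDeadlock A B n →
      GuardedProtocol.HasDeadlock A B (2 * Fintype.card QB - 1)) ∧
    -- Monotonicity
    (∀ n ≥ Fintype.card QB + 1,
      (GuardedProtocol.HasLocalDeadlock A B n → GuardedProtocol.HasLocalDeadlock A B (n + 1)) ∧
      (GuardedProtocol.HasGlobalDeadlock A B n → GuardedProtocol.HasGlobalDeadlock A B (n + 1)) ∧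
      (GuardedProtocol.HasDeadlock A B n → GuardedProtocol.HasDeadlock A B (n + 1))) ∧
    -- Cutoff
    (2 ≤ Fintype.card QB →
      GuardedProtocol.IsCutoff (GuardedProtocol.HasLocalDeadlock A B)
        (2 * Fintype.card QB - 1) ∧
      GuardedProtocol.IsCutoff (GuardedProtocol.HasGlobalDeadlock A B)
        (2 * Fintype.card QB - 1) ∧
      GuardedProtocol.IsCutoff (GuardedProtocol.HasDeadlock A B)
        (2 * Fintype.card QB - 1)) := by
  refine ⟨fun hc n hn h => (h.bounding hn).2 hc, fun n hn h => h.bounding hn,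
    fun n hn h => h.bounding hn, fun n hn => ⟨fun h => h.succ hn, fun h => h.succ hn,
      fun h => h.succ hn⟩, fun hc => ⟨?_, ?_, ?_⟩⟩
  · exact GuardedProtocol.isCutoff_of_succ (fun n hn h => (h.bounding hn).2 hc)
      fun n hn h => h.succ (by omega)
  · exact GuardedProtocol.isCutoff_of_succ (fun n hn h => h.bounding hn)
      fun n hn h => h.succ (by omega)
  · exact GuardedProtocol.isCutoff_of_succ (fun n hn h => h.bounding hn)
      fun n hn h => h.succ (by omega)
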